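/- All fusion categories are over $\mathbb C$: abelian, $\mathbb C$-linear, semisimple, rigid monoidal categories with bilinear tensor product, finite-dimensional morphism spaces, finitely many isomorphism classes of simple objects and $\operatorname{End}(\mathbf 1)=\mathbb C$. A tensor functor is a strong monoidal, $\mathbb C$-linear, exact and faithful functor. A category symmetry of a fusion category $\mathcal C$ is a pair $(\mathcal F,\rho)$ of a fusion category $\mathcal F$ and a tensor functor $\rho:\mathcal F\to\mathcal C$. A left Hopf monad on $\mathcal C$ is an endofunctor $T$ with a natural isomorphism $H_{X,Y}:T(X\otimes T(Y))\to T(X)\otimes T(Y)$, a natural transformation $\eta:\mathrm{Id}\to T$ and a morphism $T_0:T(\mathbf 1)\to\mathbf 1$ such that (unit constraints suppressed, $a$ the associator) $$H_{X,Y}\,\eta_{X\otimes T(Y)}=\eta_X\otimes \mathrm{id}_{T(Y)},\quad T_0\,\eta_{\mathbf 1}=\mathrm{id}_{\mathbf 1},\quad (\mathrm{id}_{T(X)}\otimes T_0)H_{X,\mathbf 1}=T(\mathrm{id}_X\otimes T_0),\quad (T_0\otimes \mathrm{id}_{T(X)})H_{\mathbf 1,X}T(\eta_X)=\mathrm{id}_{T(X)},$$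 $$(\mathrm{id}_{T(X)}\otimes H_{Y,Z})H_{X,Y\otimes T(Z)}=a_{T(X),T(Y),T(Z)}(H_{X,Y}\otimes \mathrm{id}_{T(Z)})H_{X\otimes T(Y),Z}\,T(a^{-1}_{X,T(Y),T(Z)})\,T(\mathrm{id}_X\otimes H_{Y,Z}).$$ Put $\mu_X=(T_0\otimes \mathrm{id}_{T(X)})H_{\mathbf 1,X}:T^2(X)\to T(X)$ and $T_2(X,Y)=H_{X,Y}T(\mathrm{id}_X\otimes\eta_Y):T(X\otimes Y)\to T(X)\otimes T(Y)$. $T$ is a Hopf monad if moreover the right fusion operator $H^r_{X,Y}=(\mu_X\otimes \mathrm{id}_{T(Y)})T_2(T(X),Y):T(T(X)\otimes Y)\to T(X)\otimes T(Y)$ is invertible. A $T$-module is a pair $(M,r)$ with $r:T(M)\to M$, $rT(r)=r\mu_M$, $r\eta_M=\mathrm{id}_M$; the category $\mathcal C^T$ of $T$-modules is monoidal with $(M,r)\otimes(N,s)=(M\otimes N,(r\otimes s)T_2(M,N))$ and unit $(\mathbf 1,T_0)$. $T$ is semisimple if every $T$-module is a retract, in $\mathcal C^T$, of a free module $(T(X),\mu_X)$.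 **Proposition 1.** Let $\mathcal C$ be a fusion category. (1) If $T$ is a $\mathbb C$-linear semisimple Hopf monad on $\mathcal C$, then $(\mathcal C^T,U)$, with $U:\mathcal C^T\to\mathcal C$ the forgetful functor, is a category symmetry of $\mathcal C$: $\mathcal C^T$ is a fusion category and $U$ is a tensor functor. (2) Conversely, let $(\mathcal F,\rho)$ be a category symmetry of $\mathcal C$. Then $\rho$ has a left adjoint, and for every left adjoint $G$ of $\rho$ the endofunctor $T=\rho G$ of $\mathcal C$ is a $\mathbb C$-linear semisimple Hopf monad, whose unit $\eta$ is the unit of the adjunction, whose multiplication $\mu$ is $\rho$ applied to the counit $\varepsilon$ at $G$, and whose $T_2$, $T_0$ are induced by the comonoidal structure of $G$ adjoint to the monoidal structure of $\rho$. There is a $\mathbb C$-linear monoidal equivalence $K:\mathcal F\to\mathcal C^T$ together with a monoidal natural isomorphism $UK\cong\rho$ which, for every object $Y$ of $\mathcal F$, carries the $T$-action on $K(Y)$ to $\rho(\varepsilon_Y):T(\rho (Y))\to\rho (Y)$. In particular $(\mathcal F,\rho)$ is equivalent to $(\mathcal C^T,U)$. -/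

import Mathlib

open CategoryTheory CategoryTheory.Limits CategoryTheory.MonoidalCategory

universe v₁ v₂ u₁ u₂

/-- A fusion category over `ℂ`: an abelian `ℂ`-linear category which is rigid monoidal with
bilinear tensor product, has finite-dimensional morphism spaces, is semisimple (every object is a
finite direct sum of simple objects) with finitely many isomorphism classes of simple objects, and
whose unit object has the scalars as endomorphisms. -/
class IsFusionCategory (C : Type u₁) [Category.{v₁} C] [Preadditive C] [Linear ℂ C]
    [MonoidalCategory C] : Prop where
  /-- the given preadditive category is abelian -/
  abelian : ∃ A : Abelian C, A.toPreadditive = ‹Preadditive C›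
  monoidalPreadditive : MonoidalPreadditive C
  monoidalLinear : MonoidalLinear ℂ C
  rigid : Nonempty (RigidCategory C)
  finite_hom : ∀ X Y : C, Module.Finite ℂ (X ⟶ Y)
  semisimple : ∀ X : C, ∃ (n : ℕ) (S : Fin n → C) (b : Bicone S),
    (∀ i, Simple (S i)) ∧ Nonempty b.IsBilimit ∧ Nonempty (X ≅ b.pt)
  finite_simples : ∃ (n : ℕ) (S : Fin n → C), ∀ X : C, Simple X → ∃ i, Nonempty (X ≅ S i)
  finrank_end_unit : Module.finrank ℂ (𝟙_ C ⟶ 𝟙_ C) = 1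

/-- A tensor functor: a strong monoidal functor (the structure isomorphisms are the instance
`U.Monoidal`) which is `ℂ`-linear, exact and faithful. -/
structure IsTensorFunctor {C : Type u₁} [Category.{v₁} C] [Preadditive C] [Linear ℂ C]
    [MonoidalCategory C] {D : Type u₂} [Category.{v₂} D] [Preadditive D] [Linear ℂ D]
    [MonoidalCategory D] (U : D ⥤ C) [U.Monoidal] : Prop where
  additive : U.Additive
  linear : U.Linear ℂ
  faithful : U.Faithful
  preservesFiniteLimits : PreservesFiniteLimits U
  preservesFiniteColimits : PreservesFiniteColimits U

/-- `(D, U)` is a category symmetry of `C`: `D` is a fusion category and `U : D ⥤ C` is a tensor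
functor. -/
structure IsCategorySymmetry (C : Type u₁) [Category.{v₁} C] [Preadditive C] [Linear ℂ C]
    [MonoidalCategory C] (D : Type u₂) [Category.{v₂} D] [Preadditive D] [Linear ℂ D]
    [MonoidalCategory D] (U : D ⥤ C) [U.Monoidal] : Prop where
  fusion : IsFusionCategory D
  tensorFunctor : IsTensorFunctor U

/-- The structure of a left Hopf monad on an endofunctor `T` of a monoidal category: a natural
isomorphism `H` (the left fusion operator), a natural transformation `η` and a morphism `T₀`
subject to the triangle and heptagon axioms. -/
structure LeftHopfMonad {C : Type u₁} [Category.{v₁} C] [MonoidalCategory C] (T : C ⥤ C) where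
  /-- the left fusion operator -/
  H : ∀ X Y : C, T.obj (X ⊗ T.obj Y) ≅ T.obj X ⊗ T.obj Y
  /-- the unit -/
  η : 𝟭 C ⟶ T
  /-- the counit -/
  T₀ : T.obj (𝟙_ C) ⟶ 𝟙_ C
  H_naturality : ∀ {X X' Y Y' : C} (f : X ⟶ X') (g : Y ⟶ Y'),
    T.map (f ⊗ₘ T.map g) ≫ (H X' Y').hom = (H X Y).hom ≫ (T.map f ⊗ₘ T.map g)
  η_H : ∀ X Y : C, η.app (X ⊗ T.obj Y) ≫ (H X Y).hom = η.app X ▷ T.obj Y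
  η_T₀ : η.app (𝟙_ C) ≫ T₀ = 𝟙 (𝟙_ C)
  H_T₀_right : ∀ X : C,
    (H X (𝟙_ C)).hom ≫ T.obj X ◁ T₀ ≫ (ρ_ (T.obj X)).hom = T.map (X ◁ T₀ ≫ (ρ_ X).hom)
  H_T₀_left : ∀ X : C,
    T.map (η.app X) ≫ T.map (λ_ (T.obj X)).inv ≫ (H (𝟙_ C) X).hom ≫ T₀ ▷ T.obj X ≫
      (λ_ (T.obj X)).hom = 𝟙 (T.obj X)
  heptagon : ∀ X Y Z : C,
    (H X (Y ⊗ T.obj Z)).hom ≫ T.obj X ◁ (H Y Z).hom =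
      T.map (X ◁ (H Y Z).hom) ≫ T.map (α_ X (T.obj Y) (T.obj Z)).inv ≫
        (H (X ⊗ T.obj Y) Z).hom ≫ (H X Y).hom ▷ T.obj Z ≫
        (α_ (T.obj X) (T.obj Y) (T.obj Z)).hom

lemma smul_act {C : Type u₁} [Category.{v₁} C] [Preadditive C] [Linear ℂ C] (T : C ⥤ C)
    [T.Additive] [T.Linear ℂ] {M N : C} (r : T.obj M ⟶ M) (s : T.obj N ⟶ N) (c : ℂ) (f : M ⟶ N)
    (hf : T.map f ≫ s = r ≫ f) : T.map (c • f) ≫ s = r ≫ (c • f) := by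
  rw [T.map_smul, Linear.smul_comp, Linear.comp_smul, hf]

namespace LeftHopfMonad

variable {C : Type u₁} [Category.{v₁} C] [MonoidalCategory C] {T : C ⥤ C} (h : LeftHopfMonad T)

/-- The multiplication `μ_X = (T₀ ⊗ id) H_{𝟙,X} : T (T X) ⟶ T X`. -/
def mul (X : C) : T.obj (T.obj X) ⟶ T.obj X :=
  T.map (λ_ (T.obj X)).inv ≫ (h.H (𝟙_ C) X).hom ≫ h.T₀ ▷ T.obj X ≫ (λ_ (T.obj X)).hom

/-- The comonoidal structure `T₂(X,Y) = H_{X,Y} T(id ⊗ η_Y) : T (X ⊗ Y) ⟶ T X ⊗ T Y`. -/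
def comul (X Y : C) : T.obj (X ⊗ Y) ⟶ T.obj X ⊗ T.obj Y :=
  T.map (X ◁ h.η.app Y) ≫ (h.H X Y).hom

/-- The right fusion operator `Hʳ_{X,Y} = (μ_X ⊗ id) T₂(T X, Y)`. -/
def rightFusion (X Y : C) : T.obj (T.obj X ⊗ Y) ⟶ T.obj X ⊗ T.obj Y :=
  h.comul (T.obj X) Y ≫ h.mul X ▷ T.obj Y

lemma η_nat {X Y : C} (f : X ⟶ Y) : f ≫ h.η.app Y = h.η.app X ≫ T.map f := h.η.naturality f

lemma H_left {X X' : C} (f : X ⟶ X') (Y : C) :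
    T.map (f ▷ T.obj Y) ≫ (h.H X' Y).hom = (h.H X Y).hom ≫ T.map f ▷ T.obj Y := by
  simpa using h.H_naturality f (𝟙 Y)

lemma H_right (X : C) {Y Y' : C} (g : Y ⟶ Y') :
    T.map (X ◁ T.map g) ≫ (h.H X Y').hom = (h.H X Y).hom ≫ T.obj X ◁ T.map g := by
  simpa using h.H_naturality (𝟙 X) g

lemma mul_nat {X Y : C} (f : X ⟶ Y) : T.map (T.map f) ≫ h.mul Y = h.mul X ≫ T.map f := by
  have h1 : T.map f ≫ (λ_ (T.obj Y)).inv = (λ_ (T.obj X)).inv ≫ (𝟙_ C) ◁ T.map f := by simp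
  unfold mul
  rw [← T.map_comp_assoc, h1, T.map_comp_assoc]
  slice_lhs 2 3 => rw [h.H_right]
  simp only [Category.assoc]
  rw [whisker_exchange_assoc]
  simp

lemma T_map_η_mul (X : C) : T.map (h.η.app X) ≫ h.mul X = 𝟙 _ := h.H_T₀_left X

lemma η_mul (X : C) : h.η.app (T.obj X) ≫ h.mul X = 𝟙 _ := by
  unfold mul
  rw [← Category.assoc, ← h.η_nat, Category.assoc]
  slice_lhs 2 3 => rw [h.η_H]
  rw [← comp_whiskerRight, h.η_T₀]
  simp

lemma mul_H (Y Z : C) : h.mul (Y ⊗ T.obj Z) ≫ (h.H Y Z).hom =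
    T.map (h.H Y Z).hom ≫ (h.H (T.obj Y) Z).hom ≫ h.mul Y ▷ T.obj Z := by
  have h1 : T.map (λ_ (T.obj (Y ⊗ T.obj Z))).inv ≫ T.map ((𝟙_ C) ◁ (h.H Y Z).hom) ≫
      T.map (α_ (𝟙_ C) (T.obj Y) (T.obj Z)).inv =
      T.map (h.H Y Z).hom ≫ T.map ((λ_ (T.obj Y)).inv ▷ T.obj Z) := by
    simp only [← T.map_comp]
    congr 1
    simp
  calc h.mul (Y ⊗ T.obj Z) ≫ (h.H Y Z).hom
      = T.map (λ_ _).inv ≫ ((h.H (𝟙_ C) (Y ⊗ T.obj Z)).hom ≫ T.obj (𝟙_ C) ◁ (h.H Y Z).hom) ≫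
        h.T₀ ▷ _ ≫ (λ_ _).hom := by
        simp only [mul, Category.assoc, whisker_exchange_assoc, leftUnitor_naturality]
    _ = (T.map (λ_ (T.obj (Y ⊗ T.obj Z))).inv ≫ T.map ((𝟙_ C) ◁ (h.H Y Z).hom) ≫
      T.map (α_ (𝟙_ C) (T.obj Y) (T.obj Z)).inv) ≫ (h.H (𝟙_ C ⊗ T.obj Y) Z).hom ≫
        (h.H (𝟙_ C) Y).hom ▷ T.obj Z ≫
        (α_ (T.obj (𝟙_ C)) (T.obj Y) (T.obj Z)).hom ≫ h.T₀ ▷ _ ≫ (λ_ _).hom := by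
        rw [h.heptagon]; simp only [Category.assoc]
    _ = T.map (h.H Y Z).hom ≫ (T.map ((λ_ (T.obj Y)).inv ▷ T.obj Z) ≫
        (h.H (𝟙_ C ⊗ T.obj Y) Z).hom) ≫
        (h.H (𝟙_ C) Y).hom ▷ T.obj Z ≫
        (α_ (T.obj (𝟙_ C)) (T.obj Y) (T.obj Z)).hom ≫ h.T₀ ▷ _ ≫ (λ_ _).hom := by
        rw [h1]; simp only [Category.assoc]
    _ = _ := by
        rw [h.H_left]
        simp [mul]

lemma mul_T₀ : h.mul (𝟙_ C) ≫ h.T₀ = T.map h.T₀ ≫ h.T₀ := by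
  have h1 := h.H_T₀_right (𝟙_ C)
  have h2 : h.mul (𝟙_ C) ≫ h.T₀ = T.map (λ_ _).inv ≫ ((h.H (𝟙_ C) (𝟙_ C)).hom ≫
      T.obj (𝟙_ C) ◁ h.T₀ ≫ (ρ_ (T.obj (𝟙_ C))).hom) ≫ h.T₀ := by
    simp only [mul, Category.assoc]
    congr 2
    rw [← rightUnitor_naturality, whisker_exchange_assoc, ← leftUnitor_naturality, unitors_equal]
  rw [h2, h1, ← T.map_comp_assoc]
  congr 2
  rw [← unitors_equal]
  simp

lemma mul_assoc' (X : C) : T.map (h.mul X) ≫ h.mul X = h.mul (T.obj X) ≫ h.mul X := by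
  have hA := h.mul_H (𝟙_ C) X
  have h2 : h.mul (T.obj X) ≫ h.mul X =
      T.map (T.map (λ_ (T.obj X)).inv) ≫ (h.mul (𝟙_ C ⊗ T.obj X) ≫ (h.H (𝟙_ C) X).hom) ≫
        h.T₀ ▷ T.obj X ≫ (λ_ (T.obj X)).hom := by
    rw [Category.assoc, ← Category.assoc (T.map (T.map _)), h.mul_nat, Category.assoc, mul, mul]
  rw [h2, hA]
  simp only [Category.assoc]
  rw [← comp_whiskerRight_assoc, h.mul_T₀, comp_whiskerRight_assoc]
  slice_rhs 3 4 => rw [← h.H_left]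
  have h3 : T.map (h.mul X) ≫ T.map (λ_ (T.obj X)).inv = T.map (T.map (λ_ (T.obj X)).inv) ≫
      T.map (h.H (𝟙_ C) X).hom ≫ T.map (h.T₀ ▷ T.obj X) := by
    simp only [← T.map_comp]
    congr 1
    simp [mul]
  have h4 : T.map (h.mul X) ≫ h.mul X = (T.map (h.mul X) ≫ T.map (λ_ (T.obj X)).inv) ≫
      (h.H (𝟙_ C) X).hom ≫ h.T₀ ▷ T.obj X ≫ (λ_ (T.obj X)).hom := by
    rw [Category.assoc]; rfl
  rw [h4, h3]
  simp only [Category.assoc]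

/-- The monad `(T, μ, η)` underlying a left Hopf monad. -/
def toMonad : Monad C where
  toFunctor := T
  η := h.η
  μ := { app := h.mul, naturality := fun _ _ f => h.mul_nat f }
  assoc := h.mul_assoc'
  left_unit := h.η_mul
  right_unit := h.T_map_η_mul

lemma comul_nat {X X' Y Y' : C} (f : X ⟶ X') (g : Y ⟶ Y') :
    T.map (f ⊗ₘ g) ≫ h.comul X' Y' = h.comul X Y ≫ (T.map f ⊗ₘ T.map g) := by
  unfold comul
  rw [Category.assoc, ← h.H_naturality, ← T.map_comp_assoc, ← T.map_comp_assoc]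
  congr 2
  rw [tensorHom_comp_whiskerLeft, whiskerLeft_comp_tensorHom, h.η_nat]

lemma η_comul (X Y : C) : h.η.app (X ⊗ Y) ≫ h.comul X Y = h.η.app X ⊗ₘ h.η.app Y := by
  unfold comul
  rw [← Category.assoc, ← h.η_nat, Category.assoc, h.η_H, tensorHom_def']
  rfl

lemma comul_T₀ (X : C) : h.comul X (𝟙_ C) ≫ T.obj X ◁ h.T₀ ≫ (ρ_ (T.obj X)).hom =
    T.map (ρ_ X).hom := by
  unfold comul
  rw [Category.assoc, h.H_T₀_right, ← T.map_comp, ← whiskerLeft_comp_assoc, h.η_T₀]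
  simp

lemma T₀_comul (X : C) : h.comul (𝟙_ C) X ≫ h.T₀ ▷ T.obj X ≫ (λ_ (T.obj X)).hom =
    T.map (λ_ X).hom := by
  have h1 := h.H_T₀_left X
  have h2 : T.map ((𝟙_ C) ◁ h.η.app X) =
      T.map (λ_ X).hom ≫ T.map (h.η.app X) ≫ T.map (λ_ (T.obj X)).inv := by
    simp only [← T.map_comp]
    congr 1
    simp
  unfold comul
  rw [h2]
  simp only [Category.assoc]
  rw [h1, Category.comp_id]

lemma comul_assoc (X Y Z : C) :
    h.comul (X ⊗ Y) Z ≫ h.comul X Y ▷ T.obj Z ≫ (α_ (T.obj X) (T.obj Y) (T.obj Z)).hom =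
      T.map (α_ X Y Z).hom ≫ h.comul X (Y ⊗ Z) ≫ T.obj X ◁ h.comul Y Z := by
  have e1 : h.comul X (Y ⊗ Z) ≫ T.obj X ◁ h.comul Y Z =
      T.map (X ◁ h.η.app (Y ⊗ Z)) ≫ T.map (X ◁ T.map (Y ◁ h.η.app Z)) ≫
        (h.H X (Y ⊗ T.obj Z)).hom ≫ T.obj X ◁ (h.H Y Z).hom := by
    simp only [comul, Category.assoc, whiskerLeft_comp]
    slice_rhs 2 3 => rw [h.H_right]
    simp only [Category.assoc]
  have e2 : T.map (X ◁ h.η.app (Y ⊗ Z)) ≫ T.map (X ◁ T.map (Y ◁ h.η.app Z)) ≫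
      T.map (X ◁ (h.H Y Z).hom) = T.map (X ◁ (h.η.app Y ⊗ₘ h.η.app Z)) := by
    simp only [← T.map_comp, ← whiskerLeft_comp]
    rw [← Category.assoc, ← h.η_nat, Category.assoc, h.η_H, tensorHom_def']
    rfl
  have e3 : T.map (α_ X Y Z).hom ≫ T.map (X ◁ (h.η.app Y ⊗ₘ h.η.app Z)) ≫
      T.map (α_ X (T.obj Y) (T.obj Z)).inv =
      T.map ((X ⊗ Y) ◁ h.η.app Z) ≫ T.map ((X ◁ h.η.app Y) ▷ T.obj Z) := by
    simp only [← T.map_comp]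
    congr 1
    rw [tensorHom_def']
    simp
  rw [e1, h.heptagon]
  slice_rhs 2 4 => rw [e2]
  slice_rhs 1 3 => rw [e3]
  simp only [comul, Category.assoc, comp_whiskerRight]
  slice_rhs 2 3 => rw [h.H_left]
  simp only [Category.assoc]
  rfl

lemma comul_mul (X Y : C) : h.comul X (T.obj Y) ≫ T.obj X ◁ h.mul Y = (h.H X Y).hom := by
  have e0 : T.obj X ◁ h.mul Y = T.obj X ◁ T.map (λ_ (T.obj Y)).inv ≫
      T.obj X ◁ (h.H (𝟙_ C) Y).hom ≫ T.obj X ◁ (h.T₀ ▷ T.obj Y) ≫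
        T.obj X ◁ (λ_ (T.obj Y)).hom := by
    simp [mul]
  have e1 : (h.H X (𝟙_ C)).hom ▷ T.obj Y ≫ (α_ (T.obj X) (T.obj (𝟙_ C)) (T.obj Y)).hom ≫
      T.obj X ◁ (h.T₀ ▷ T.obj Y) ≫ T.obj X ◁ (λ_ (T.obj Y)).hom =
      T.map (X ◁ h.T₀ ≫ (ρ_ X).hom) ▷ T.obj Y := by
    rw [← h.H_T₀_right]
    simp
  have e2 : h.η.app (T.obj Y) ≫ T.map (λ_ (T.obj Y)).inv ≫ (h.H (𝟙_ C) Y).hom =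
      (λ_ (T.obj Y)).inv ≫ h.η.app (𝟙_ C) ▷ T.obj Y := by
    rw [← Category.assoc, ← h.η_nat, Category.assoc, h.η_H]
  have e3 : X ◁ ((λ_ (T.obj Y)).inv ≫ h.η.app (𝟙_ C) ▷ T.obj Y) ≫
      (α_ X (T.obj (𝟙_ C)) (T.obj Y)).inv ≫ (X ◁ h.T₀ ≫ (ρ_ X).hom) ▷ T.obj Y = 𝟙 _ := by
    have e4 : (α_ X (T.obj (𝟙_ C)) (T.obj Y)).inv ≫ (X ◁ h.T₀ ≫ (ρ_ X).hom) ▷ T.obj Y =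
        X ◁ (h.T₀ ▷ T.obj Y ≫ (λ_ (T.obj Y)).hom) := by simp
    rw [e4, ← whiskerLeft_comp, Category.assoc, ← comp_whiskerRight_assoc, h.η_T₀]
    simp
  rw [e0, comul, Category.assoc]
  slice_lhs 2 3 => rw [← h.H_right]
  slice_lhs 3 4 => rw [h.heptagon]
  simp only [Category.assoc]
  rw [e1, ← h.H_left]
  simp only [← T.map_comp_assoc, ← whiskerLeft_comp_assoc]
  rw [e2, e3, T.map_id, Category.id_comp]

lemma mul_comul (X Y : C) : h.mul (X ⊗ Y) ≫ h.comul X Y =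
    T.map (h.comul X Y) ≫ h.comul (T.obj X) (T.obj Y) ≫ (h.mul X ⊗ₘ h.mul Y) := by
  rw [tensorHom_def', reassoc_of% h.comul_mul (T.obj X) Y, comul, T.map_comp, Category.assoc,
    ← h.mul_H, ← Category.assoc, ← h.mul_nat, Category.assoc]

lemma tensor_act_unit {M N : C} (r : T.obj M ⟶ M) (s : T.obj N ⟶ N)
    (hr : h.η.app M ≫ r = 𝟙 M) (hs : h.η.app N ≫ s = 𝟙 N) :
    h.η.app (M ⊗ N) ≫ h.comul M N ≫ (r ⊗ₘ s) = 𝟙 (M ⊗ N) := by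
  rw [← Category.assoc, h.η_comul, tensorHom_comp_tensorHom, hr, hs]
  exact id_tensorHom_id _ _

lemma tensor_act_assoc {M N : C} (r : T.obj M ⟶ M) (s : T.obj N ⟶ N)
    (hr : h.mul M ≫ r = T.map r ≫ r) (hs : h.mul N ≫ s = T.map s ≫ s) :
    h.mul (M ⊗ N) ≫ h.comul M N ≫ (r ⊗ₘ s) =
      T.map (h.comul M N ≫ (r ⊗ₘ s)) ≫ h.comul M N ≫ (r ⊗ₘ s) := by
  rw [← Category.assoc, h.mul_comul, T.map_comp]
  simp only [Category.assoc]
  rw [reassoc_of% h.comul_nat r s, tensorHom_comp_tensorHom, tensorHom_comp_tensorHom, hr, hs]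

lemma tensor_act_hom {M N M' N' : C} (r : T.obj M ⟶ M) (s : T.obj N ⟶ N) (r' : T.obj M' ⟶ M')
    (s' : T.obj N' ⟶ N') (f : M ⟶ M') (g : N ⟶ N') (hf : T.map f ≫ r' = r ≫ f)
    (hg : T.map g ≫ s' = s ≫ g) :
    T.map (f ⊗ₘ g) ≫ h.comul M' N' ≫ (r' ⊗ₘ s') = (h.comul M N ≫ (r ⊗ₘ s)) ≫ (f ⊗ₘ g) := by
  rw [reassoc_of% h.comul_nat f g, Category.assoc, tensorHom_comp_tensorHom,
    tensorHom_comp_tensorHom, hf, hg]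

lemma tensor_act_associator {M N P : C} (r : T.obj M ⟶ M) (s : T.obj N ⟶ N) (t : T.obj P ⟶ P) :
    T.map (α_ M N P).hom ≫ h.comul M (N ⊗ P) ≫ (r ⊗ₘ (h.comul N P ≫ (s ⊗ₘ t))) =
      (h.comul (M ⊗ N) P ≫ ((h.comul M N ≫ (r ⊗ₘ s)) ⊗ₘ t)) ≫ (α_ M N P).hom := by
  rw [← whiskerLeft_comp_tensorHom, ← whiskerRight_comp_tensorHom]
  simp only [Category.assoc]
  rw [associator_naturality, reassoc_of% h.comul_assoc]

lemma tensor_act_leftUnitor {M : C} (r : T.obj M ⟶ M) :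
    T.map (λ_ M).hom ≫ r = (h.comul (𝟙_ C) M ≫ (h.T₀ ⊗ₘ r)) ≫ (λ_ M).hom := by
  rw [← h.T₀_comul, CategoryTheory.MonoidalCategory.tensorHom_def]
  simp

lemma tensor_act_rightUnitor {M : C} (r : T.obj M ⟶ M) :
    T.map (ρ_ M).hom ≫ r = (h.comul M (𝟙_ C) ≫ (r ⊗ₘ h.T₀)) ≫ (ρ_ M).hom := by
  rw [← h.comul_T₀, CategoryTheory.MonoidalCategory.tensorHom_def']
  simp

/-- The category `C^T` of `T`-modules: objects are pairs `(M, r)` with `r : T M ⟶ M` compatible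
with `μ` and `η`. -/
abbrev Mod : Type (max u₁ v₁) := h.toMonad.Algebra

/-- The forgetful functor `C^T ⥤ C`. -/
abbrev forget : h.Mod ⥤ C := h.toMonad.forget

/-- The tensor product `(M, r) ⊗ (N, s) = (M ⊗ N, (r ⊗ s) T₂(M,N))` of modules. -/
def tensorMod (M N : h.Mod) : h.Mod where
  A := M.A ⊗ N.A
  a := h.comul M.A N.A ≫ (M.a ⊗ₘ N.a)
  unit := h.tensor_act_unit M.a N.a M.unit N.unit
  assoc := h.tensor_act_assoc M.a N.a M.assoc N.assoc

/-- The unit module `(𝟙, T₀)`. -/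
def unitMod : h.Mod where
  A := 𝟙_ C
  a := h.T₀
  unit := h.η_T₀
  assoc := h.mul_T₀

/-- The tensor product of two module morphisms. -/
def tensorModHom {M M' N N' : h.Mod} (f : M ⟶ M') (g : N ⟶ N') :
    h.tensorMod M N ⟶ h.tensorMod M' N' where
  f := f.f ⊗ₘ g.f
  h := h.tensor_act_hom M.a N.a M'.a N'.a f.f g.f f.h g.h

/-- The associator of `C` as an isomorphism of modules. -/
def assocMod (M N P : h.Mod) :
    h.tensorMod (h.tensorMod M N) P ≅ h.tensorMod M (h.tensorMod N P) :=
  Monad.Algebra.isoMk (α_ M.A N.A P.A) (h.tensor_act_associator M.a N.a P.a)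

/-- The left unitor of `C` as an isomorphism of modules. -/
def leftUnitorMod (M : h.Mod) : h.tensorMod h.unitMod M ≅ M :=
  Monad.Algebra.isoMk (λ_ M.A) (h.tensor_act_leftUnitor M.a)

/-- The right unitor of `C` as an isomorphism of modules. -/
def rightUnitorMod (M : h.Mod) : h.tensorMod M h.unitMod ≅ M :=
  Monad.Algebra.isoMk (ρ_ M.A) (h.tensor_act_rightUnitor M.a)

instance : MonoidalCategoryStruct h.Mod where
  tensorObj := h.tensorMod
  tensorUnit := h.unitMod
  tensorHom := h.tensorModHom
  whiskerLeft M _ _ g := h.tensorModHom (𝟙 M) g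
  whiskerRight f N := h.tensorModHom f (𝟙 N)
  associator := h.assocMod
  leftUnitor := h.leftUnitorMod
  rightUnitor := h.rightUnitorMod

/-- The forgetful functor strictly preserves the tensor structure. -/
def inducingData : Monoidal.InducingFunctorData h.forget where
  μIso M N := Iso.refl (M.A ⊗ N.A)
  εIso := Iso.refl (𝟙_ C)
  whiskerLeft_eq M _ _ f := by
    change (𝟙 M.A ⊗ₘ f.f) = 𝟙 _ ≫ (M.A ◁ f.f) ≫ 𝟙 _
    simp
  whiskerRight_eq f N := by
    change (f.f ⊗ₘ 𝟙 N.A) = 𝟙 _ ≫ (f.f ▷ N.A) ≫ 𝟙 _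
    simp
  tensorHom_eq f g := by
    change (f.f ⊗ₘ g.f) = 𝟙 _ ≫ (f.f ⊗ₘ g.f) ≫ 𝟙 _
    simp
  associator_eq M N P := by
    change (α_ M.A N.A P.A).hom = (𝟙 _ ≫ (𝟙 _ ⊗ₘ 𝟙 _)) ≫ (α_ M.A N.A P.A).hom ≫
      (𝟙 _ ⊗ₘ 𝟙 _) ≫ 𝟙 _
    simp
  leftUnitor_eq M := by
    change (λ_ M.A).hom = (𝟙 _ ≫ (𝟙 _ ⊗ₘ 𝟙 _)) ≫ (λ_ M.A).hom
    simp
  rightUnitor_eq M := by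
    change (ρ_ M.A).hom = (𝟙 _ ≫ (𝟙 _ ⊗ₘ 𝟙 _)) ≫ (ρ_ M.A).hom
    simp

/-- The monoidal category of `T`-modules. -/
instance : MonoidalCategory h.Mod := Monoidal.induced h.forget h.inducingData

/-- The forgetful functor is (strict, in particular strong) monoidal. -/
instance : h.forget.Monoidal := Monoidal.fromInducedMonoidal h.forget h.inducingData

/-- A Hopf monad is semisimple if every module is a retract of a free module `(T X, μ_X)`. -/
def IsSemisimple : Prop :=
  ∀ M : h.Mod, ∃ X : C, Nonempty (Retract M (h.toMonad.free.obj X))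

section Linear

variable [Preadditive C]

instance [T.Additive] : h.toMonad.toFunctor.Additive := inferInstanceAs T.Additive

/-- The `ℂ`-linear structure on modules over a linear Hopf monad, computed in `C`. -/
instance [Linear ℂ C] [T.Additive] [T.Linear ℂ] : Linear ℂ h.Mod where
  homModule M N :=
    { smul := fun c f =>
        { f := c • f.f
          h := smul_act T M.a N.a c f.f f.h }
      one_smul := fun f => Monad.Algebra.Hom.ext (one_smul ℂ f.f)
      mul_smul := fun a b f => Monad.Algebra.Hom.ext (mul_smul a b f.f)
      smul_zero := fun a => Monad.Algebra.Hom.ext (smul_zero (A := (M.A ⟶ N.A)) a)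
      smul_add := fun a f g => Monad.Algebra.Hom.ext (smul_add a f.f g.f)
      add_smul := fun a b f => Monad.Algebra.Hom.ext (add_smul a b f.f)
      zero_smul := fun f => Monad.Algebra.Hom.ext (zero_smul ℂ f.f) }
  smul_comp _ _ _ c f g := Monad.Algebra.Hom.ext (Linear.smul_comp _ _ _ c f.f g.f)
  comp_smul _ _ _ f c g := Monad.Algebra.Hom.ext (Linear.comp_smul _ _ _ f.f c g.f)

end Linear

end LeftHopfMonad

/-- A Hopf monad: a left Hopf monad which is also a right Hopf monad, i.e. whose right fusion
operator is invertible. -/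
structure HopfMonad {C : Type u₁} [Category.{v₁} C] [MonoidalCategory C] (T : C ⥤ C) extends
    LeftHopfMonad T where
  isIso_rightFusion : ∀ X Y : C, IsIso (toLeftHopfMonad.rightFusion X Y)

/-- A Hopf monad structure on `T = ρ G`, for `G` left adjoint to a strong monoidal functor `ρ`, is
the one induced by the adjunction if its unit is the unit of the adjunction, its multiplication is
`ρ` of the counit, and `T₂`, `T₀` come from the comonoidal structure of `G` that is adjoint to the
monoidal structure of `ρ`. -/
structure HopfMonad.IsInducedBy {C : Type u₁} [Category.{v₁} C] [MonoidalCategory C]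
    {F : Type u₂} [Category.{v₂} F] [MonoidalCategory F] {G : C ⥤ F} {ρ : F ⥤ C} [ρ.Monoidal]
    (h : HopfMonad (G ⋙ ρ)) (adj : G ⊣ ρ) : Prop where
  η_eq : h.η = adj.unit
  mul_eq : ∀ X : C, h.mul X = ρ.map (adj.counit.app (G.obj X))
  comul_eq : ∀ X Y : C, h.comul X Y =
    ρ.map ((adj.homEquiv (X ⊗ Y) (G.obj X ⊗ G.obj Y)).symm
      ((adj.unit.app X ⊗ₘ adj.unit.app Y) ≫ Functor.LaxMonoidal.μ ρ (G.obj X) (G.obj Y))) ≫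
      Functor.OplaxMonoidal.δ ρ (G.obj X) (G.obj Y)
  T₀_eq : h.T₀ = ρ.map ((adj.homEquiv (𝟙_ C) (𝟙_ F)).symm (Functor.LaxMonoidal.ε ρ)) ≫
    Functor.OplaxMonoidal.η ρ

/-! Semisimplicity is handled through one criterion: a hom-finite abelian category is a category of
finite direct sums of simple objects exactly when its epimorphisms split
(`isSplitEpi_of_hasSimpleDecomposition`, `hasSimpleDecomposition_of_isSplitEpi`). Additive functors
out of such a category are automatically exact.

From monads to symmetries: `T` is exact, so the modules form an abelian category with kernels and
cokernels computed in `C`. All objects of `C` are projective, hence so are free modules, hence so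
are their retracts; semisimplicity of `T` therefore makes every epimorphism of modules split. A
simple module receives a nonzero map from the free module on some simple object of `C`, which leaves
finitely many candidates. The action on the dual of a module `M` is forced by requiring evaluation
to be a module map. It exists once the fusion operators with coefficients in `M` are invertible: for
free modules these are `H` and the right fusion operator, and invertibility passes to retracts.

From symmetries to monads: a left adjoint `G` exists because `ρ` is left exact and there are
finitely many simple objects. Duals in the source give the projection formula `G (X ⊗ ρ Y) ≅ G X ⊗
Y` and its mirror image (`isIso_projectionLeft`, `isIso_projectionRight`), whose images under `ρ`
are the fusion operators of `ρ G`. Beck's monadicity argument, with `ρ` faithful and right exact,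
makes the comparison functor an equivalence (`comparison_isEquivalence`), and it inherits the
monoidal structure of `ρ`. Since the counit `G ρ Y ⟶ Y` is a split epimorphism, every module is a
retract of a free one. -/

/-! ### Semisimple hom-finite categories: splitting, exactness and left adjoints. -/

section Semisimple

variable {C : Type u₁} [Category.{v₁} C]

/-- An object is a finite direct sum of simple objects. -/
def HasSimpleDecomposition [Preadditive C] (X : C) : Prop :=
  ∃ (n : ℕ) (S : Fin n → C) (b : Bicone S),
    (∀ i, Simple (S i)) ∧ Nonempty b.IsBilimit ∧ Nonempty (X ≅ b.pt)

/-- A direct sum decomposition into simple objects in terms of inclusions and projections. -/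
structure SimpleDecomposition [Preadditive C] (X : C) (ι : Type) [Fintype ι] where
  /-- the summands -/
  S : ι → C
  /-- the projections -/
  p : ∀ j, X ⟶ S j
  /-- the inclusions -/
  i : ∀ j, S j ⟶ X
  simple : ∀ j, Simple (S j)
  i_p_self : ∀ j, i j ≫ p j = 𝟙 _
  i_p_ne : ∀ j k, j ≠ k → i j ≫ p k = 0
  total : ∑ j, p j ≫ i j = 𝟙 X

lemma SimpleDecomposition.hasSimpleDecomposition [Preadditive C] {X : C} {ι : Type} [Fintype ι]
    (d : SimpleDecomposition X ι) : HasSimpleDecomposition X := by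
  classical
  let e := (Fintype.equivFin ι).symm
  let b : Bicone (fun k => d.S (e k)) :=
    { pt := X
      π := fun k => d.p (e k)
      ι := fun k => d.i (e k)
      ι_π := by
        intro j k
        split_ifs with h
        · subst h
          simpa using d.i_p_self (e j)
        · exact d.i_p_ne _ _ fun h' => h (e.injective h') }
  refine ⟨_, _, b, fun k => d.simple _, ⟨isBilimitOfTotal b ?_⟩, ⟨Iso.refl _⟩⟩
  rw [← d.total]
  exact Fintype.sum_equiv e _ _ fun _ => rfl

lemma HasSimpleDecomposition.exists_decomposition [Preadditive C] {X : C}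
    (h : HasSimpleDecomposition X) : ∃ n : ℕ, Nonempty (SimpleDecomposition X (Fin n)) := by
  classical
  obtain ⟨n, S, b, hS, ⟨hb⟩, ⟨e⟩⟩ := h
  refine ⟨n, ⟨{
    S := S
    p := fun j => e.hom ≫ b.π j
    i := fun j => b.ι j ≫ e.inv
    simple := hS
    i_p_self := fun j => by simp
    i_p_ne := fun j k h => ?_
    total := ?_ }⟩⟩
  · simp [b.ι_π, h]
  · have := IsBilimit.total hb
    calc ∑ j, (e.hom ≫ b.π j) ≫ b.ι j ≫ e.inv = e.hom ≫ (∑ j, b.π j ≫ b.ι j) ≫ e.inv := by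
          simp [Preadditive.sum_comp, Preadditive.comp_sum]
      _ = 𝟙 X := by rw [this]; simp

/-- In an abelian category whose objects are direct sums of simple objects, epimorphisms split. -/
lemma isSplitEpi_of_hasSimpleDecomposition [Abelian C] (hC : ∀ X : C, HasSimpleDecomposition X)
    {X Y : C} (f : X ⟶ Y) [Epi f] : IsSplitEpi f := by
  -- A nonzero map from a direct sum of simples to a simple object is nonzero on some summand, where
  -- Schur's lemma makes it invertible.
  have simple_case : ∀ {P S : C} (g : P ⟶ S) [Epi g], Simple S → ∃ s, s ≫ g = 𝟙 S := by
    intro P S g _ hS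
    obtain ⟨n, ⟨d⟩⟩ := (hC P).exists_decomposition
    have hg : g ≠ 0 := by
      intro h0
      have : 𝟙 S = 0 := by
        rw [← cancel_epi g, h0]; simp
      exact id_nonzero S this
    obtain ⟨j, hj⟩ : ∃ j, d.i j ≫ g ≠ 0 := by
      by_contra! hall
      apply hg
      rw [← Category.id_comp g, ← d.total, Preadditive.sum_comp]
      exact Finset.sum_eq_zero fun j _ => by rw [Category.assoc, hall, comp_zero]
    have := d.simple j
    have := isIso_of_hom_simple hj
    exact ⟨inv (d.i j ≫ g) ≫ d.i j, by simp⟩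
  obtain ⟨n, ⟨d⟩⟩ := (hC Y).exists_decomposition
  -- The pullback of `f` along a simple summand of `Y` is still an epimorphism, so the simple case
  -- lifts each summand to `X`; the lifts add up to a section.
  have lift : ∀ j, ∃ s : d.S j ⟶ X, s ≫ f = d.i j := by
    intro j
    obtain ⟨s, hs⟩ := simple_case (pullback.snd f (d.i j)) (d.simple j)
    exact ⟨s ≫ pullback.fst f (d.i j), by rw [Category.assoc, pullback.condition, reassoc_of% hs]⟩
  choose s hs using lift
  refine ⟨⟨∑ j, d.p j ≫ s j, ?_⟩⟩
  rw [Preadditive.sum_comp, ← d.total]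
  exact Finset.sum_congr rfl fun j _ => by rw [Category.assoc, hs]

/-- If epimorphisms split, every additive functor is exact. -/
lemma preservesFiniteLimits_and_colimits_of_isSplitEpi [Abelian C] {D : Type u₂} [Category.{v₂} D]
    [Abelian D] (hC : ∀ {X Y : C} (f : X ⟶ Y) [Epi f], IsSplitEpi f) (F : C ⥤ D) [F.Additive] :
    PreservesFiniteLimits F ∧ PreservesFiniteColimits F := by
  refine (F.exact_tfae.out 0 3).1 fun S hS => ?_
  have := hS.mono_f
  have := hS.epi_g
  have := hC S.g
  exact ((ShortComplex.Splitting.ofExactOfSection S hS.exact (section_ S.g)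
    (IsSplitEpi.id S.g) hS.mono_f).map F).shortExact

variable [Abelian C] [Linear ℂ C]

/-- A proper retract has a strictly smaller endomorphism algebra. -/
lemma finrank_end_lt_of_retract [∀ X Y : C, Module.Finite ℂ (X ⟶ Y)] {X Y : C} (i : Y ⟶ X)
    (r : X ⟶ Y) (h : i ≫ r = 𝟙 Y) (hi : ¬ IsIso i) :
    Module.finrank ℂ (Y ⟶ Y) < Module.finrank ℂ (X ⟶ X) := by
  let φ : (Y ⟶ Y) →ₗ[ℂ] (X ⟶ X) :=
    { toFun := fun a => r ≫ a ≫ i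
      map_add' := fun a b => by simp
      map_smul' := fun c a => by simp }
  have hφ : Function.Injective φ := by
    intro a b hab
    have : i ≫ (r ≫ a ≫ i) ≫ r = i ≫ (r ≫ b ≫ i) ≫ r := by
      change i ≫ φ a ≫ r = i ≫ φ b ≫ r
      rw [hab]
    simpa [h, reassoc_of% h] using this
  rw [← LinearMap.finrank_range_of_inj hφ]
  apply Submodule.finrank_lt
  -- If `a ↦ r a i` reached the identity of `X`, then `a` would be the identity of `Y`, and `r` a
  -- two-sided inverse of `i`.
  intro htop
  obtain ⟨a, ha⟩ : 𝟙 X ∈ LinearMap.range φ := htop ▸ Submodule.mem_top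
  have ha' : r ≫ a ≫ i = 𝟙 X := ha
  have ha1 : a = 𝟙 Y := by
    have := i ≫= ha' =≫ r
    simpa [h, reassoc_of% h] using this
  exact hi ⟨r, h, by simpa [ha1] using ha'⟩

/-- In a hom-finite abelian category in which epimorphisms split, every object is a finite direct
sum of simple objects. -/
lemma hasSimpleDecomposition_of_isSplitEpi [∀ X Y : C, Module.Finite ℂ (X ⟶ Y)]
    (hC : ∀ {X Y : C} (f : X ⟶ Y) [Epi f], IsSplitEpi f) (X : C) : HasSimpleDecomposition X := by
  suffices H : ∀ (n : ℕ) (X : C), Module.finrank ℂ (X ⟶ X) = n →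
      ∃ (ι : Type) (_ : Fintype ι), Nonempty (SimpleDecomposition X ι) by
    obtain ⟨ι, _, ⟨d⟩⟩ := H _ X rfl
    exact d.hasSimpleDecomposition
  intro n
  induction n using Nat.strong_induction_on with
  | _ n ih =>
    intro X hX
    by_cases hzero : 𝟙 X = 0
    · exact ⟨Empty, inferInstance, ⟨{
        S := fun e => e.elim, p := fun e => e.elim, i := fun e => e.elim, simple := fun e => e.elim
        i_p_self := fun e => e.elim, i_p_ne := fun e => e.elim, total := by simp [hzero] }⟩⟩
    by_cases hsimple : Simple X
    · exact ⟨Unit, inferInstance, ⟨{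
        S := fun _ => X, p := fun _ => 𝟙 X, i := fun _ => 𝟙 X, simple := fun _ => hsimple
        i_p_self := by simp, i_p_ne := fun j k h => (h rfl).elim, total := by simp }⟩⟩
    -- A nonzero object that is not simple has a proper nonzero subobject. It splits off, and both
    -- it and its complement are proper retracts, so their endomorphism algebras are smaller and the
    -- induction applies.
    obtain ⟨Y, i, hmono, hne, hiso⟩ : ∃ (Y : C) (i : Y ⟶ X), Mono i ∧ i ≠ 0 ∧ ¬ IsIso i := by
      by_contra! hall
      refine hsimple ⟨fun {Y} f _ => ⟨fun h h0 => ?_, fun h0 => hall Y f inferInstance h0⟩⟩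
      subst h0
      exact hzero (by rw [← IsIso.inv_hom_id (0 : Y ⟶ X)]; simp)
    let S := ShortComplex.mk i (cokernel.π i) (cokernel.condition i)
    have hS : S.Exact := ShortComplex.exact_of_g_is_cokernel S (cokernelIsCokernel i)
    have := hC (cokernel.π i)
    let σ := ShortComplex.Splitting.ofExactOfSection S hS (section_ S.g) (IsSplitEpi.id S.g) hmono
    have h1 : i ≫ σ.r = 𝟙 Y := σ.f_r
    have h2 : σ.s ≫ cokernel.π i = 𝟙 _ := σ.s_g
    have h3 : σ.r ≫ i + cokernel.π i ≫ σ.s = 𝟙 X := σ.id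
    have h4 : σ.s ≫ σ.r = 0 := σ.s_r
    have hsiso : ¬ IsIso σ.s := by
      intro hs
      have hr : σ.r = 0 := by
        rw [← cancel_epi σ.s, h4, comp_zero]
      apply hne
      rw [← Category.id_comp i, ← h1, hr]
      simp
    obtain ⟨ι₁, _, ⟨d₁⟩⟩ := ih _ (hX ▸ finrank_end_lt_of_retract i σ.r h1 hiso) Y rfl
    obtain ⟨ι₂, _, ⟨d₂⟩⟩ := ih _ (hX ▸ finrank_end_lt_of_retract σ.s _ h2 hsiso) _ rfl
    refine ⟨ι₁ ⊕ ι₂, inferInstance, ⟨{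
      S := Sum.elim d₁.S d₂.S
      p := fun j => match j with
        | .inl a => σ.r ≫ d₁.p a
        | .inr b => cokernel.π i ≫ d₂.p b
      i := fun j => match j with
        | .inl a => d₁.i a ≫ i
        | .inr b => d₂.i b ≫ σ.s
      simple := ?_, i_p_self := ?_, i_p_ne := ?_, total := ?_ }⟩⟩
    · rintro (a | b)
      exacts [d₁.simple a, d₂.simple b]
    · rintro (a | b)
      · simpa [reassoc_of% h1] using d₁.i_p_self a
      · simpa [reassoc_of% h2] using d₂.i_p_self b
    · rintro (a | b) (c | d) hne
      · have : (d₁.i a ≫ i) ≫ σ.r ≫ d₁.p c = 0 := by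
          rw [Category.assoc, reassoc_of% h1, d₁.i_p_ne a c fun h => hne (by rw [h])]
        exact this
      · have : (d₁.i a ≫ i) ≫ cokernel.π i ≫ d₂.p d = 0 := by simp
        exact this
      · have : (d₂.i b ≫ σ.s) ≫ σ.r ≫ d₁.p c = 0 := by simp [reassoc_of% h4]
        exact this
      · have : (d₂.i b ≫ σ.s) ≫ cokernel.π i ≫ d₂.p d = 0 := by
          rw [Category.assoc, reassoc_of% h2, d₂.i_p_ne b d fun h => hne (by rw [h])]
        exact this
    · rw [Fintype.sum_sum_type, ← h3]
      congr 1
      · calc _ = σ.r ≫ (∑ a, d₁.p a ≫ d₁.i a) ≫ i := by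
              simp [Preadditive.sum_comp, Preadditive.comp_sum]
          _ = _ := by rw [d₁.total, Category.id_comp]
      · calc _ = cokernel.π i ≫ (∑ a, d₂.p a ≫ d₂.i a) ≫ σ.s := by
              simp [Preadditive.sum_comp, Preadditive.comp_sum]
          _ = _ := by rw [d₂.total, Category.id_comp]

/-- A linear left exact functor from a semisimple category with finitely many simple objects to a
hom-finite category has a left adjoint. -/
lemma isRightAdjoint_of_semisimple [∀ X Y : C, Module.Finite ℂ (X ⟶ Y)]
    (hC : ∀ X : C, HasSimpleDecomposition X)
    (hfin : ∃ (n : ℕ) (S : Fin n → C), ∀ X : C, Simple X → ∃ i, Nonempty (X ≅ S i))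
    {D : Type u₂} [Category.{v₂} D] [Preadditive D] [Linear ℂ D]
    [∀ X Y : D, Module.Finite ℂ (X ⟶ Y)] (ρ : C ⥤ D) [ρ.Additive] [ρ.Linear ℂ]
    [PreservesFiniteLimits ρ] : ρ.IsRightAdjoint := by
  rw [isRightAdjoint_iff_hasInitial_structuredArrow]
  intro X
  obtain ⟨n, S, hS⟩ := hfin
  let WeaklyInitial (P : C) (u : X ⟶ ρ.obj P) : Prop :=
    ∀ (Y : C) (f : X ⟶ ρ.obj Y), ∃ g : P ⟶ Y, u ≫ ρ.map g = f
  -- Take one copy of `S k` for each element of a basis of the maps from `X` to `ρ (S k)`, with `u`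
  -- assembled from the basis vectors. Maps to `ρ (S k)` then factor through `u`, and decomposing
  -- `Y` extends this to all targets.
  have exists_weaklyInitial : ∃ (P : C) (u : X ⟶ ρ.obj P), WeaklyInitial P u := by
    let κ := Σ k : Fin n, Fin (Module.finrank ℂ (X ⟶ ρ.obj (S k)))
    let B : ∀ k, Module.Basis (Fin (Module.finrank ℂ (X ⟶ ρ.obj (S k)))) ℂ (X ⟶ ρ.obj (S k)) :=
      fun k => Module.finBasis ℂ _
    let Q : κ → C := fun a => S a.1
    have := Abelian.hasFiniteBiproducts (C := C)
    let u : X ⟶ ρ.obj (⨁ Q) := ∑ a : κ, B a.1 a.2 ≫ ρ.map (biproduct.ι Q a)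
    have hu : ∀ a : κ, u ≫ ρ.map (biproduct.π Q a) = B a.1 a.2 := by
      classical
      intro a
      rw [Preadditive.sum_comp, Finset.sum_eq_single a]
      · rw [Category.assoc, ← ρ.map_comp, biproduct.ι_π_self, ρ.map_id, Category.comp_id]
      · intro b _ hb
        rw [Category.assoc, ← ρ.map_comp, biproduct.ι_π_ne _ hb, ρ.map_zero, comp_zero]
      · simp
    have hsimple : ∀ k (f : X ⟶ ρ.obj (S k)), ∃ g : ⨁ Q ⟶ S k, u ≫ ρ.map g = f := by
      intro k f
      refine ⟨∑ j, (B k).repr f j • biproduct.π Q ⟨k, j⟩, ?_⟩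
      rw [ρ.map_sum, Preadditive.comp_sum, ← (B k).sum_repr f]
      refine Finset.sum_congr rfl fun j _ => ?_
      rw [ρ.map_smul, Linear.comp_smul, hu, (B k).sum_repr f]
    refine ⟨⨁ Q, u, fun Y f => ?_⟩
    obtain ⟨m, ⟨d⟩⟩ := (hC Y).exists_decomposition
    have : ∀ j, ∃ g : ⨁ Q ⟶ d.S j, u ≫ ρ.map g = f ≫ ρ.map (d.p j) := by
      intro j
      obtain ⟨k, ⟨e⟩⟩ := hS _ (d.simple j)
      obtain ⟨g, hg⟩ := hsimple k (f ≫ ρ.map (d.p j) ≫ ρ.map e.hom)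
      refine ⟨g ≫ e.inv, ?_⟩
      rw [ρ.map_comp, reassoc_of% hg, ← ρ.map_comp, e.hom_inv_id, ρ.map_id, Category.comp_id]
    choose g hg using this
    refine ⟨∑ j, g j ≫ d.i j, ?_⟩
    have htot : ∑ j, ρ.map (d.p j) ≫ ρ.map (d.i j) = 𝟙 _ := by
      simp_rw [← ρ.map_comp]
      rw [← ρ.map_sum, d.total, ρ.map_id]
    conv_rhs => rw [← Category.comp_id f, ← htot]
    rw [ρ.map_sum, Preadditive.comp_sum, Preadditive.comp_sum]
    refine Finset.sum_congr rfl fun j _ => ?_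
    rw [ρ.map_comp, reassoc_of% (hg j)]
  -- The list `S` may repeat an isomorphism class or contain objects that are not simple, so
  -- factorizations through the sum need not be unique. Uniqueness comes from a weakly initial
  -- object whose endomorphism algebra has least dimension.
  let p : ℕ → Prop := fun m =>
    ∃ (P : C) (u : X ⟶ ρ.obj P), WeaklyInitial P u ∧ Module.finrank ℂ (P ⟶ P) = m
  have hp : ∃ m, p m := by
    obtain ⟨P, u, hP⟩ := exists_weaklyInitial
    exact ⟨_, P, u, hP, rfl⟩
  classical
  obtain ⟨P, u, hP, hdim⟩ := Nat.find_spec hp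
  have hmin := fun m (h : m < Nat.find hp) => Nat.find_min hp h
  have uniq : ∀ (Y : C) (a b : P ⟶ Y), u ≫ ρ.map a = u ≫ ρ.map b → a = b := by
    intro Y a b hab
    have hk : IsLimit (Fork.ofι (ρ.map (equalizer.ι a b)) (by
        rw [← ρ.map_comp, equalizer.condition, ρ.map_comp]) : Fork (ρ.map a) (ρ.map b)) :=
      isLimitForkMapOfIsLimit ρ _ (equalizerIsEqualizer a b)
    obtain ⟨u', hu'⟩ := Fork.IsLimit.lift' hk u hab
    have hu'' : u' ≫ ρ.map (equalizer.ι a b) = u := hu'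
    -- As `ρ` preserves equalizers, `u` factors through the image of the equalizer of `a` and `b`,
    -- which is thus again weakly initial. Being a retract of `P`, it is all of `P` by minimality,
    -- so `a = b`.
    have hE : WeaklyInitial (equalizer a b) u' := by
      intro Z f
      obtain ⟨g, hg⟩ := hP Z f
      exact ⟨equalizer.ι a b ≫ g, by rw [ρ.map_comp, reassoc_of% hu'', hg]⟩
    obtain ⟨r, hr⟩ := hP _ u'
    have hepi : ∃ s : P ⟶ equalizer a b, equalizer.ι a b ≫ s = 𝟙 _ := by
      have := isSplitEpi_of_hasSimpleDecomposition hC (cokernel.π (equalizer.ι a b))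
      let T := ShortComplex.mk (equalizer.ι a b) _ (cokernel.condition (equalizer.ι a b))
      have hT : T.Exact := ShortComplex.exact_of_g_is_cokernel T (cokernelIsCokernel _)
      let σ := ShortComplex.Splitting.ofExactOfSection T hT (section_ T.g) (IsSplitEpi.id T.g)
        (inferInstanceAs (Mono (equalizer.ι a b)))
      exact ⟨σ.r, σ.f_r⟩
    obtain ⟨s, hs⟩ := hepi
    by_cases hiso : IsIso (equalizer.ι a b)
    · rw [← cancel_epi (equalizer.ι a b), equalizer.condition]
    · exact (hmin _ (hdim ▸ finrank_end_lt_of_retract _ s hs hiso) ⟨_, u', hE, rfl⟩).elim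
  refine (IsInitial.ofUniqueHom (X := StructuredArrow.mk u)
    (fun A => StructuredArrow.homMk (hP A.right A.hom).choose (hP A.right A.hom).choose_spec)
    fun A m => ?_).hasInitial
  ext
  apply uniq
  have h1 := StructuredArrow.w m
  have h2 := (hP A.right A.hom).choose_spec
  exact h1.trans h2.symm

end Semisimple

/-! ### Abelianness of the category of modules. -/

section MonadAlgebra

variable {C : Type u₁} [Category.{v₁} C]

lemma algebra_hasFiniteLimits [HasFiniteLimits C] (T : Monad C) : HasFiniteLimits T.Algebra :=
  ⟨fun _ _ _ => ⟨fun D => Monad.hasLimit_of_comp_forget_hasLimit D⟩⟩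

lemma algebra_hasFiniteColimits [HasFiniteColimits C] (T : Monad C)
    [PreservesFiniteColimits (T : C ⥤ C)] : HasFiniteColimits T.Algebra :=
  ⟨fun _ _ _ => ⟨fun D => Monad.forget_creates_colimits_of_monad_preserves D⟩⟩

lemma algebra_forget_preservesFiniteLimits [HasFiniteLimits C] (T : Monad C) :
    PreservesFiniteLimits T.forget :=
  ⟨fun _ _ _ => inferInstance⟩

lemma algebra_forget_preservesFiniteColimits [HasFiniteColimits C] (T : Monad C)
    [PreservesFiniteColimits (T : C ⥤ C)] : PreservesFiniteColimits T.forget :=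
  ⟨fun _ _ _ => inferInstance⟩

/-- The category of algebras over an additive right exact monad on an abelian category is
abelian. -/
@[reducible]
noncomputable def algebraAbelian [Abelian C] (T : Monad C) [(T : C ⥤ C).Additive]
    [PreservesFiniteColimits (T : C ⥤ C)] : Abelian T.Algebra := by
  have := algebra_hasFiniteLimits T
  have := algebra_hasFiniteColimits T
  have := algebra_forget_preservesFiniteLimits T
  have := algebra_forget_preservesFiniteColimits T
  have : HasFiniteProducts T.Algebra := inferInstance
  -- The forgetful functor is exact and reflects isomorphisms, so the comparison of coimage with
  -- image may be inverted in `C`.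
  have : ∀ {X Y : T.Algebra} (f : X ⟶ Y), IsIso (Abelian.coimageImageComparison f) := by
    intro X Y f
    have h1 : IsIso (T.forget.map (Abelian.coimageImageComparison f)) := by
      rw [Arrow.isIso_iff_isIso_of_isIso
        (Abelian.PreservesCoimageImageComparison.iso T.forget f).hom]
      infer_instance
    exact isIso_of_reflects_iso _ T.forget
  exact Abelian.ofCoimageImageComparisonIsIso

end MonadAlgebra

/-! ### Morphisms into a dual as pairings. -/

section Duality

variable {C : Type u₁} [Category.{v₁} C] [MonoidalCategory C]

/-- Transposition along the duality. Together with the injectivity statement below, it lets an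
action on a dual be defined, and its axioms tested, by what happens after evaluation. -/
lemma exists_whiskerRight_comp_evaluation {N D : C} [ExactPairing N D] {A : C}
    (g : A ⊗ N ⟶ 𝟙_ C) : ∃ d : A ⟶ D, d ▷ N ≫ ε_ N D = g := by
  let : HasRightDual N := ⟨D⟩
  refine ⟨tensorRightHomEquiv A N D (𝟙_ C) g ≫ (λ_ D).hom, ?_⟩
  apply (tensorRightHomEquiv A N D (𝟙_ C)).injective
  refine (tensorRightHomEquiv_whiskerRight_comp_evaluation (X := N) _).trans ?_
  exact (Category.assoc _ _ _).trans ((congrArg _ (Iso.hom_inv_id _)).trans (Category.comp_id _))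

lemma whiskerRight_comp_evaluation_injective {N D : C} [ExactPairing N D] {A : C} {d d' : A ⟶ D}
    (h : d ▷ N ≫ ε_ N D = d' ▷ N ≫ ε_ N D) : d = d' := by
  let : HasRightDual N := ⟨D⟩
  have h1 := congrArg (tensorRightHomEquiv A N D (𝟙_ C)) h
  have h2 := (tensorRightHomEquiv_whiskerRight_comp_evaluation (X := N) d).symm.trans
    (h1.trans (tensorRightHomEquiv_whiskerRight_comp_evaluation (X := N) d'))
  exact (cancel_mono _).1 h2

lemma exists_whiskerLeft_comp_evaluation {N D : C} [ExactPairing D N] {A : C}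
    (g : N ⊗ A ⟶ 𝟙_ C) : ∃ d : A ⟶ D, N ◁ d ≫ ε_ D N = g := by
  let : HasLeftDual N := ⟨D⟩
  refine ⟨tensorLeftHomEquiv A D N (𝟙_ C) g ≫ (ρ_ D).hom, ?_⟩
  apply (tensorLeftHomEquiv A D N (𝟙_ C)).injective
  refine (tensorLeftHomEquiv_whiskerLeft_comp_evaluation (Z := N) _).trans ?_
  exact (Category.assoc _ _ _).trans ((congrArg _ (Iso.hom_inv_id _)).trans (Category.comp_id _))

lemma whiskerLeft_comp_evaluation_injective {N D : C} [ExactPairing D N] {A : C} {d d' : A ⟶ D}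
    (h : N ◁ d ≫ ε_ D N = N ◁ d' ≫ ε_ D N) : d = d' := by
  let : HasLeftDual N := ⟨D⟩
  have h1 := congrArg (tensorLeftHomEquiv A D N (𝟙_ C)) h
  have h2 := (tensorLeftHomEquiv_whiskerLeft_comp_evaluation (Z := N) d).symm.trans
    (h1.trans (tensorLeftHomEquiv_whiskerLeft_comp_evaluation (Z := N) d'))
  exact (cancel_mono _).1 h2

end Duality

/-! ### Fusion operators with coefficients in a module, and actions on duals. -/

namespace LeftHopfMonad

variable {C : Type u₁} [Category.{v₁} C] [MonoidalCategory C] {T : C ⥤ C} (h : LeftHopfMonad T)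

lemma comul_nat_left {X X' : C} (f : X ⟶ X') (Y : C) :
    T.map (f ▷ Y) ≫ h.comul X' Y = h.comul X Y ≫ T.map f ▷ T.obj Y := by
  simpa using h.comul_nat f (𝟙 Y)

lemma comul_nat_right (X : C) {Y Y' : C} (f : Y ⟶ Y') :
    T.map (X ◁ f) ≫ h.comul X Y' = h.comul X Y ≫ T.obj X ◁ T.map f := by
  simpa using h.comul_nat (𝟙 X) f

/-- The left fusion operator with coefficients in a module. -/
def fusionLeft (X : C) {N : C} (s : T.obj N ⟶ N) : T.obj (X ⊗ N) ⟶ T.obj X ⊗ N :=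
  h.comul X N ≫ T.obj X ◁ s

/-- The right fusion operator with coefficients in a module. -/
def fusionRight {N : C} (s : T.obj N ⟶ N) (X : C) : T.obj (N ⊗ X) ⟶ N ⊗ T.obj X :=
  h.comul N X ≫ s ▷ T.obj X

lemma fusionLeft_mul (X Y : C) : h.fusionLeft X (h.mul Y) = (h.H X Y).hom := h.comul_mul X Y

variable {N : C} (s : T.obj N ⟶ N)

lemma fusionLeft_nat_mod (X : C) {N' : C} (s' : T.obj N' ⟶ N') (f : N ⟶ N')
    (hf : T.map f ≫ s' = s ≫ f) :
    T.map (X ◁ f) ≫ h.fusionLeft X s' = h.fusionLeft X s ≫ T.obj X ◁ f := by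
  rw [fusionLeft, fusionLeft, reassoc_of% h.comul_nat_right, Category.assoc, ← whiskerLeft_comp,
    ← whiskerLeft_comp, hf]

lemma fusionRight_nat_mod (X : C) {N' : C} (s' : T.obj N' ⟶ N') (f : N ⟶ N')
    (hf : T.map f ≫ s' = s ≫ f) :
    T.map (f ▷ X) ≫ h.fusionRight s' X = h.fusionRight s X ≫ f ▷ T.obj X := by
  rw [fusionRight, fusionRight, reassoc_of% h.comul_nat_left, Category.assoc, ← comp_whiskerRight,
    ← comp_whiskerRight, hf]

lemma fusionLeft_nat {X X' : C} (f : X ⟶ X') :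
    T.map (f ▷ N) ≫ h.fusionLeft X' s = h.fusionLeft X s ≫ T.map f ▷ N := by
  rw [fusionLeft, fusionLeft, reassoc_of% h.comul_nat_left, Category.assoc, whisker_exchange]

lemma fusionRight_nat {X X' : C} (f : X ⟶ X') :
    T.map (N ◁ f) ≫ h.fusionRight s X' = h.fusionRight s X ≫ N ◁ T.map f := by
  rw [fusionRight, fusionRight, reassoc_of% h.comul_nat_right, Category.assoc, whisker_exchange]

lemma η_fusionLeft (hs : h.η.app N ≫ s = 𝟙 N) (X : C) :
    h.η.app (X ⊗ N) ≫ h.fusionLeft X s = h.η.app X ▷ N := by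
  rw [fusionLeft, reassoc_of% h.η_comul, MonoidalCategory.tensorHom_def, Category.assoc,
    ← whiskerLeft_comp]
  erw [hs]
  simp

lemma η_fusionRight (hs : h.η.app N ≫ s = 𝟙 N) (X : C) :
    h.η.app (N ⊗ X) ≫ h.fusionRight s X = N ◁ h.η.app X := by
  rw [fusionRight, reassoc_of% h.η_comul, MonoidalCategory.tensorHom_def', Category.assoc,
    ← comp_whiskerRight]
  erw [hs]
  simp

/-- Compatibility of `μ` with `T₂`, combined with associativity of the action `s`. This is what
yields associativity of the action on the dual. -/
lemma mul_fusionLeft (hs : h.mul N ≫ s = T.map s ≫ s) (X : C) :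
    h.mul (X ⊗ N) ≫ h.fusionLeft X s =
      T.map (h.fusionLeft X s) ≫ h.fusionLeft (T.obj X) s ≫ h.mul X ▷ N := by
  simp only [fusionLeft, T.map_comp, Category.assoc]
  rw [reassoc_of% h.mul_comul, reassoc_of% h.comul_nat_right, whisker_exchange,
    MonoidalCategory.tensorHom_def, Category.assoc, ← whiskerLeft_comp, hs, whiskerLeft_comp]
  simp only [← whisker_exchange, ← whisker_exchange_assoc]

lemma mul_fusionRight (hs : h.mul N ≫ s = T.map s ≫ s) (X : C) :
    h.mul (N ⊗ X) ≫ h.fusionRight s X =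
      T.map (h.fusionRight s X) ≫ h.fusionRight s (T.obj X) ≫ N ◁ h.mul X := by
  simp only [fusionRight, T.map_comp, Category.assoc]
  rw [reassoc_of% h.mul_comul, reassoc_of% h.comul_nat_left, ← whisker_exchange,
    MonoidalCategory.tensorHom_def', Category.assoc, ← comp_whiskerRight, hs, comp_whiskerRight]
  simp only [whisker_exchange, whisker_exchange_assoc]

/-- Invertibility of the left fusion operator passes to retracts. -/
lemma isIso_fusionLeft_of_retract (X : C) {P : C} (p : T.obj P ⟶ P) [IsIso (h.fusionLeft X p)]
    (i : N ⟶ P) (r : P ⟶ N) (hi : T.map i ≫ p = s ≫ i) (hr : T.map r ≫ s = p ≫ r)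
    (hir : i ≫ r = 𝟙 N) : IsIso (h.fusionLeft X s) := by
  refine ⟨T.obj X ◁ i ≫ inv (h.fusionLeft X p) ≫ T.map (X ◁ r), ?_, ?_⟩
  · rw [← reassoc_of% h.fusionLeft_nat_mod s X p i hi, IsIso.hom_inv_id_assoc, ← T.map_comp,
      ← whiskerLeft_comp, hir]
    simp
  · rw [Category.assoc, Category.assoc, h.fusionLeft_nat_mod p X s r hr, IsIso.inv_hom_id_assoc,
      ← whiskerLeft_comp, hir]
    simp

/-- Invertibility of the right fusion operator passes to retracts. -/
lemma isIso_fusionRight_of_retract (X : C) {P : C} (p : T.obj P ⟶ P) [IsIso (h.fusionRight p X)]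
    (i : N ⟶ P) (r : P ⟶ N) (hi : T.map i ≫ p = s ≫ i) (hr : T.map r ≫ s = p ≫ r)
    (hir : i ≫ r = 𝟙 N) : IsIso (h.fusionRight s X) := by
  refine ⟨i ▷ T.obj X ≫ inv (h.fusionRight p X) ≫ T.map (r ▷ X), ?_, ?_⟩
  · rw [← reassoc_of% h.fusionRight_nat_mod s X p i hi, IsIso.hom_inv_id_assoc, ← T.map_comp,
      ← comp_whiskerRight, hir]
    simp
  · rw [Category.assoc, Category.assoc, h.fusionRight_nat_mod p X s r hr, IsIso.inv_hom_id_assoc,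
      ← comp_whiskerRight, hir]
    simp

lemma fusionLeft_comp_whiskerRight {X Y : C} (f : T.obj X ⟶ Y) :
    h.fusionLeft X s ≫ f ▷ N = h.comul X N ≫ (f ⊗ₘ s) := by
  rw [fusionLeft, Category.assoc, MonoidalCategory.tensorHom_def']

lemma fusionRight_comp_whiskerLeft {X Y : C} (f : T.obj X ⟶ Y) :
    h.fusionRight s X ≫ N ◁ f = h.comul N X ≫ (s ⊗ₘ f) := by
  rw [fusionRight, Category.assoc, MonoidalCategory.tensorHom_def]

/-- The right dual of a module whose left fusion operators are invertible: there is an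
action on the right dual for which evaluation and coevaluation are module morphisms. -/
lemma exists_action_rightDual (hs₁ : h.η.app N ≫ s = 𝟙 N) (hs₂ : h.mul N ≫ s = T.map s ≫ s)
    [∀ X, IsIso (h.fusionLeft X s)] (D : C) [ExactPairing N D] :
    ∃ d : T.obj D ⟶ D, h.η.app D ≫ d = 𝟙 D ∧ h.mul D ≫ d = T.map d ≫ d ∧
      T.map (ε_ N D) ≫ h.T₀ = (h.comul D N ≫ (d ⊗ₘ s)) ≫ ε_ N D ∧
      T.map (η_ N D) ≫ h.comul N D ≫ (s ⊗ₘ d) = h.T₀ ≫ η_ N D := by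
  -- The equation saying that evaluation is a module map, solved for `d` by inverting the fusion
  -- operator.
  obtain ⟨d, hd⟩ := exists_whiskerRight_comp_evaluation (D := D)
    (inv (h.fusionLeft D s) ≫ T.map (ε_ N D) ≫ h.T₀)
  have hd' : h.fusionLeft D s ≫ d ▷ N ≫ ε_ N D = T.map (ε_ N D) ≫ h.T₀ := by
    rw [hd, IsIso.hom_inv_id_assoc]
  have hev : (h.comul D N ≫ (d ⊗ₘ s)) ≫ ε_ N D = T.map (ε_ N D) ≫ h.T₀ := by
    rw [← hd', ← h.fusionLeft_comp_whiskerRight, Category.assoc]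
  refine ⟨d, ?_, ?_, hev.symm, ?_⟩
  · apply whiskerRight_comp_evaluation_injective (N := N)
    have h1 : (h.η.app D ≫ d) ▷ N ≫ ε_ N D = h.η.app D ▷ N ≫ d ▷ N ≫ ε_ N D := by
      rw [← comp_whiskerRight_assoc]
    have h2 := h.η_nat (ε_ N D)
    rw [h1, ← h.η_fusionLeft s hs₁, Category.assoc, hd', ← Category.assoc, ← h2, Category.assoc,
      h.η_T₀]
    simp
  -- Tested after evaluation and after precomposing with two invertible fusion operators; both sides
  -- then reduce to evaluation followed by `T₀`.
  · apply whiskerRight_comp_evaluation_injective (N := N)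
    rw [← cancel_epi (h.fusionLeft (T.obj D) s), ← cancel_epi (T.map (h.fusionLeft D s)),
      comp_whiskerRight, comp_whiskerRight, Category.assoc, Category.assoc,
      ← reassoc_of% h.mul_fusionLeft s hs₂, hd', ← reassoc_of% h.mul_nat, h.mul_T₀,
      ← reassoc_of% h.fusionLeft_nat s d, hd', ← T.map_comp_assoc, ← T.map_comp_assoc,
      ← T.map_comp_assoc, Category.assoc, hd']
  -- Linearity of coevaluation is checked on transposes: the zigzag identities remove the
  -- coevaluation, and after the fusion operator at the unit both sides become `T` of the left
  -- unitor followed by `s`.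
  · apply (tensorRightHomEquiv (T.obj (𝟙_ C)) N D N).symm.injective
    change (_ ▷ N ≫ (α_ N D N).hom ≫ N ◁ ε_ N D ≫ (ρ_ N).hom) =
      (_ ▷ N ≫ (α_ N D N).hom ≫ N ◁ ε_ N D ≫ (ρ_ N).hom)
    have key : h.fusionLeft (N ⊗ D) s ≫ (h.comul N D ≫ (s ⊗ₘ d)) ▷ N ≫ (α_ N D N).hom ≫
        N ◁ ε_ N D ≫ (ρ_ N).hom =
        T.map (α_ N D N).hom ≫ T.map (N ◁ ε_ N D) ≫ T.map (ρ_ N).hom ≫ s := by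
      have h1 := h.tensor_act_associator s d s
      rw [reassoc_of% h.fusionLeft_comp_whiskerRight]
      rw [Category.assoc] at h1
      rw [← reassoc_of% h1, tensorHom_comp_whiskerLeft_assoc, hev,
        ← whiskerLeft_comp_tensorHom_assoc, ← reassoc_of% h.comul_nat_right,
        h.tensor_act_rightUnitor, Category.assoc]
    have h3 : T.map (η_ N D ▷ N) ≫ T.map (α_ N D N).hom ≫ T.map (N ◁ ε_ N D) ≫
        T.map (ρ_ N).hom = T.map (λ_ N).hom := by
      simp only [← T.map_comp]
      simp
    rw [← cancel_epi (h.fusionLeft (𝟙_ C) s), comp_whiskerRight, Category.assoc,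
      ← reassoc_of% h.fusionLeft_nat s (η_ N D), key, reassoc_of% h3, comp_whiskerRight,
      Category.assoc, reassoc_of% h.fusionLeft_comp_whiskerRight,
      ExactPairing.evaluation_coevaluation_assoc, h.tensor_act_leftUnitor]
    simp

/-- The left dual of a module whose right fusion operators are invertible: there is an
action on the left dual for which evaluation and coevaluation are module morphisms. -/
lemma exists_action_leftDual (hs₁ : h.η.app N ≫ s = 𝟙 N) (hs₂ : h.mul N ≫ s = T.map s ≫ s)
    [∀ X, IsIso (h.fusionRight s X)] (D : C) [ExactPairing D N] :
    ∃ d : T.obj D ⟶ D, h.η.app D ≫ d = 𝟙 D ∧ h.mul D ≫ d = T.map d ≫ d ∧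
      T.map (ε_ D N) ≫ h.T₀ = (h.comul N D ≫ (s ⊗ₘ d)) ≫ ε_ D N ∧
      T.map (η_ D N) ≫ h.comul D N ≫ (d ⊗ₘ s) = h.T₀ ≫ η_ D N := by
  obtain ⟨d, hd⟩ := exists_whiskerLeft_comp_evaluation (D := D)
    (inv (h.fusionRight s D) ≫ T.map (ε_ D N) ≫ h.T₀)
  have hd' : h.fusionRight s D ≫ N ◁ d ≫ ε_ D N = T.map (ε_ D N) ≫ h.T₀ := by
    rw [hd, IsIso.hom_inv_id_assoc]
  have hev : (h.comul N D ≫ (s ⊗ₘ d)) ≫ ε_ D N = T.map (ε_ D N) ≫ h.T₀ := by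
    rw [← hd', ← h.fusionRight_comp_whiskerLeft, Category.assoc]
  refine ⟨d, ?_, ?_, hev.symm, ?_⟩
  · apply whiskerLeft_comp_evaluation_injective (N := N)
    have h1 : N ◁ (h.η.app D ≫ d) ≫ ε_ D N = N ◁ h.η.app D ≫ N ◁ d ≫ ε_ D N := by
      rw [← whiskerLeft_comp_assoc]
    have h2 := h.η_nat (ε_ D N)
    rw [h1, ← h.η_fusionRight s hs₁, Category.assoc, hd', ← Category.assoc, ← h2, Category.assoc,
      h.η_T₀]
    simp
  · apply whiskerLeft_comp_evaluation_injective (N := N)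
    rw [← cancel_epi (h.fusionRight s (T.obj D)), ← cancel_epi (T.map (h.fusionRight s D)),
      whiskerLeft_comp, whiskerLeft_comp, Category.assoc, Category.assoc,
      ← reassoc_of% h.mul_fusionRight s hs₂, hd', ← reassoc_of% h.mul_nat, h.mul_T₀,
      ← reassoc_of% h.fusionRight_nat s d, hd', ← T.map_comp_assoc, ← T.map_comp_assoc,
      ← T.map_comp_assoc, Category.assoc, hd']
  · apply (tensorLeftHomEquiv (T.obj (𝟙_ C)) D N N).symm.injective
    change (N ◁ _ ≫ (α_ N D N).inv ≫ ε_ D N ▷ N ≫ (λ_ N).hom) =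
      (N ◁ _ ≫ (α_ N D N).inv ≫ ε_ D N ▷ N ≫ (λ_ N).hom)
    have key : h.fusionRight s (D ⊗ N) ≫ N ◁ (h.comul D N ≫ (d ⊗ₘ s)) ≫ (α_ N D N).inv ≫
        ε_ D N ▷ N ≫ (λ_ N).hom =
        T.map (α_ N D N).inv ≫ T.map (ε_ D N ▷ N) ≫ T.map (λ_ N).hom ≫ s := by
      have h1 : T.map (α_ N D N).inv ≫ h.comul (N ⊗ D) N ≫ ((h.comul N D ≫ (s ⊗ₘ d)) ⊗ₘ s) =
          h.comul N (D ⊗ N) ≫ (s ⊗ₘ (h.comul D N ≫ (d ⊗ₘ s))) ≫ (α_ N D N).inv := by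
        have h2 := h.tensor_act_associator s d s
        rw [← cancel_mono (α_ N D N).hom]
        simp only [Category.assoc, Iso.inv_hom_id, Category.comp_id] at h2 ⊢
        rw [← h2, ← T.map_comp_assoc, Iso.inv_hom_id, T.map_id, Category.id_comp]
      rw [reassoc_of% h.fusionRight_comp_whiskerLeft, ← reassoc_of% h1,
        tensorHom_comp_whiskerRight_assoc, hev, ← whiskerRight_comp_tensorHom_assoc,
        ← reassoc_of% h.comul_nat_left, h.tensor_act_leftUnitor, Category.assoc]
    have h3 : T.map (N ◁ η_ D N) ≫ T.map (α_ N D N).inv ≫ T.map (ε_ D N ▷ N) ≫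
        T.map (λ_ N).hom = T.map (ρ_ N).hom := by
      simp only [← T.map_comp]
      simp
    rw [← cancel_epi (h.fusionRight s (𝟙_ C)), whiskerLeft_comp, Category.assoc,
      ← reassoc_of% h.fusionRight_nat s (η_ D N), key, reassoc_of% h3, whiskerLeft_comp,
      Category.assoc, reassoc_of% h.fusionRight_comp_whiskerLeft,
      ExactPairing.coevaluation_evaluation_assoc, h.tensor_act_rightUnitor]
    simp

end LeftHopfMonad

/-! ### Rigidity of the category of modules. -/

namespace HopfMonad

variable {C : Type u₁} [Category.{v₁} C] [MonoidalCategory C] {T : C ⥤ C} (h : HopfMonad T)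

/-- Semisimplicity presents `M` as a retract of a free module, on which the left fusion operator is
`H`; so the fusion operator with coefficients in `M` is invertible and the dual of the underlying
object carries an action. -/
lemma nonempty_hasRightDual (hss : h.IsSemisimple) [RightRigidCategory C] (M : h.Mod) :
    Nonempty (HasRightDual M) := by
  obtain ⟨Y, ⟨e⟩⟩ := hss M
  have (X : C) : IsIso (h.fusionLeft X M.a) := by
    have : IsIso (h.fusionLeft X (h.mul Y)) := by
      rw [h.fusionLeft_mul]; infer_instance
    exact h.isIso_fusionLeft_of_retract M.a X (h.mul Y) e.i.f e.r.f e.i.h e.r.h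
      (congrArg Monad.Algebra.Hom.f e.retract)
  obtain ⟨d, h₁, h₂, h₃, h₄⟩ := h.exists_action_rightDual M.a M.unit M.assoc (M.A)ᘁ
  let D : h.Mod := { A := (M.A)ᘁ, a := d, unit := h₁, assoc := h₂ }
  exact ⟨{
    rightDual := D
    exact :=
      { coevaluation' := { f := η_ M.A (M.A)ᘁ, h := h₄ }
        evaluation' := { f := ε_ M.A (M.A)ᘁ, h := h₃ }
        coevaluation_evaluation' := by
          apply Monad.Algebra.Hom.ext
          change (𝟙 _ ⊗ₘ η_ M.A (M.A)ᘁ) ≫ (α_ _ _ _).inv ≫ (ε_ M.A (M.A)ᘁ ⊗ₘ 𝟙 _) =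
            (ρ_ _).hom ≫ (λ_ _).inv
          simp
        evaluation_coevaluation' := by
          apply Monad.Algebra.Hom.ext
          change (η_ M.A (M.A)ᘁ ⊗ₘ 𝟙 _) ≫ (α_ _ _ _).hom ≫ (𝟙 _ ⊗ₘ ε_ M.A (M.A)ᘁ) =
            (λ_ _).hom ≫ (ρ_ _).inv
          simp } }⟩

lemma nonempty_hasLeftDual (hss : h.IsSemisimple) [LeftRigidCategory C] (M : h.Mod) :
    Nonempty (HasLeftDual M) := by
  obtain ⟨Y, ⟨e⟩⟩ := hss M
  have (X : C) : IsIso (h.fusionRight M.a X) := by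
    have : IsIso (h.fusionRight (h.mul Y) X) := h.isIso_rightFusion Y X
    exact h.isIso_fusionRight_of_retract M.a X (h.mul Y) e.i.f e.r.f e.i.h e.r.h
      (congrArg Monad.Algebra.Hom.f e.retract)
  obtain ⟨d, h₁, h₂, h₃, h₄⟩ :=
    h.exists_action_leftDual M.a M.unit M.assoc (HasLeftDual.leftDual M.A)
  let D : h.Mod := { A := (HasLeftDual.leftDual M.A), a := d, unit := h₁, assoc := h₂ }
  exact ⟨{
    leftDual := D
    exact :=
      { coevaluation' := { f := η_ (HasLeftDual.leftDual M.A) M.A, h := h₄ }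
        evaluation' := { f := ε_ (HasLeftDual.leftDual M.A) M.A, h := h₃ }
        coevaluation_evaluation' := by
          apply Monad.Algebra.Hom.ext
          change (𝟙 _ ⊗ₘ η_ (HasLeftDual.leftDual M.A) M.A) ≫ (α_ _ _ _).inv ≫
            (ε_ (HasLeftDual.leftDual M.A) M.A ⊗ₘ 𝟙 _) =
            (ρ_ _).hom ≫ (λ_ _).inv
          simp
        evaluation_coevaluation' := by
          apply Monad.Algebra.Hom.ext
          change (η_ (HasLeftDual.leftDual M.A) M.A ⊗ₘ 𝟙 _) ≫ (α_ _ _ _).hom ≫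
            (𝟙 _ ⊗ₘ ε_ (HasLeftDual.leftDual M.A) M.A) =
            (λ_ _).hom ≫ (ρ_ _).inv
          simp } }⟩

/-- Modules over a semisimple Hopf monad on a rigid category have duals. -/
lemma nonempty_rigidCategory (hss : h.IsSemisimple) [RigidCategory C] :
    Nonempty (RigidCategory h.Mod) := by
  exact ⟨{
    rightDual := fun M => (h.nonempty_hasRightDual hss M).some
    leftDual := fun M => (h.nonempty_hasLeftDual hss M).some }⟩

end HopfMonad

/-! ### Modules over a semisimple Hopf monad form a fusion category. -/

section Criterion

variable {D : Type u₂} [Category.{v₂} D] [Preadditive D] [Linear ℂ D]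

/-- A criterion for the semisimplicity part of being a fusion category, relative to a given
preadditive structure. -/
lemma hasSimpleDecomposition_of_exists_abelian (hD : ∃ A : Abelian D, A.toPreadditive = ‹_›)
    [∀ X Y : D, Module.Finite ℂ (X ⟶ Y)] (hs : ∀ {X Y : D} (f : X ⟶ Y) [Epi f], IsSplitEpi f)
    (X : D) : HasSimpleDecomposition X := by
  obtain ⟨A, rfl⟩ := hD
  exact hasSimpleDecomposition_of_isSplitEpi hs X

omit [Linear ℂ D] in
/-- If every simple object receives a nonzero morphism from one of finitely many decomposable
objects, there are finitely many simple objects. -/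
lemma finite_simples_of_exists_abelian (hD : ∃ A : Abelian D, A.toPreadditive = ‹_›)
    (hs : ∀ X : D, HasSimpleDecomposition X) {n : ℕ} (P : Fin n → D)
    (hP : ∀ M : D, Simple M → ∃ (k : Fin n) (g : P k ⟶ M), g ≠ 0) :
    ∃ (m : ℕ) (S : Fin m → D), ∀ X : D, Simple X → ∃ i, Nonempty (X ≅ S i) := by
  obtain ⟨A, rfl⟩ := hD
  choose m d using fun k => (hs (P k)).exists_decomposition
  let e := Fintype.equivFin (Σ k : Fin n, Fin (m k))
  let S : (Σ k : Fin n, Fin (m k)) → D := fun a => (d a.1).some.S a.2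
  refine ⟨_, fun a => S (e.symm a), fun M hM => ?_⟩
  obtain ⟨k, g, hg⟩ := hP M hM
  obtain ⟨j, hj⟩ : ∃ j, (d k).some.i j ≫ g ≠ 0 := by
    by_contra! hall
    apply hg
    rw [← Category.id_comp g, ← (d k).some.total, Preadditive.sum_comp]
    exact Finset.sum_eq_zero fun j _ => by rw [Category.assoc, hall, comp_zero]
  have := (d k).some.simple j
  have := isIso_of_hom_simple hj
  exact ⟨e ⟨k, j⟩, ⟨(asIso ((d k).some.i j ≫ g)).symm ≪≫
    eqToIso (congrArg S (e.symm_apply_apply ⟨k, j⟩).symm)⟩⟩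

end Criterion

namespace HopfMonad

variable {C : Type u₁} [Category.{v₁} C] [Abelian C] [Linear ℂ C] [MonoidalCategory C]
  [IsFusionCategory C]

/-- Epimorphisms of a fusion category split. -/
lemma _root_.IsFusionCategory.isSplitEpi {X Y : C} (f : X ⟶ Y) [Epi f] : IsSplitEpi f :=
  isSplitEpi_of_hasSimpleDecomposition IsFusionCategory.semisimple f

/-- The forgetful functor from the modules over a semisimple linear Hopf monad on a fusion category
is a category symmetry. -/
theorem isCategorySymmetry_mod (T : C ⥤ C) [T.Additive] [T.Linear ℂ] (h : HopfMonad T)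
    (hss : h.IsSemisimple) : IsCategorySymmetry C h.Mod h.forget := by
  have hfinC : ∀ X Y : C, Module.Finite ℂ (X ⟶ Y) := IsFusionCategory.finite_hom
  have : MonoidalPreadditive C := IsFusionCategory.monoidalPreadditive
  have : MonoidalLinear ℂ C := IsFusionCategory.monoidalLinear
  have : PreservesFiniteColimits h.toMonad.toFunctor :=
    (preservesFiniteLimits_and_colimits_of_isSplitEpi IsFusionCategory.isSplitEpi T).2
  have hab : ∃ A : Abelian h.Mod, A.toPreadditive = (inferInstance : Preadditive h.Mod) :=
    ⟨algebraAbelian h.toMonad, rfl⟩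
  have := algebra_forget_preservesFiniteLimits h.toMonad
  have := algebra_forget_preservesFiniteColimits h.toMonad
  have hlin : h.forget.Linear ℂ := ⟨fun _ _ => rfl⟩
  have hfin : ∀ M N : h.Mod, Module.Finite ℂ (M ⟶ N) := fun M N =>
    Module.Finite.of_injective (h.forget.mapLinearMap ℂ : (M ⟶ N) →ₗ[ℂ] (M.A ⟶ N.A))
      h.forget.map_injective
  -- The free functor preserves projectives because its right adjoint preserves epimorphisms;
  -- retracts of projectives are projective.
  have hproj : ∀ M : h.Mod, Projective M := by
    intro M
    obtain ⟨X, ⟨e⟩⟩ := hss M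
    have hX : Projective X := ⟨fun f e _ => by
      have := IsFusionCategory.isSplitEpi e
      exact ⟨f ≫ section_ e, by simp⟩⟩
    have : Projective (h.toMonad.free.obj X) := h.toMonad.adj.map_projective X hX
    exact e.projective
  have hsplit : ∀ {M N : h.Mod} (f : M ⟶ N) [Epi f], IsSplitEpi f := fun {M N} f _ =>
    have := hproj N
    ⟨⟨Projective.factorThru (𝟙 N) f, Projective.factorThru_comp _ _⟩⟩
  have hdec : ∀ M : h.Mod, HasSimpleDecomposition M :=
    hasSimpleDecomposition_of_exists_abelian hab hsplit
  have hpre : MonoidalPreadditive h.Mod := by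
    refine ⟨?_, ?_, ?_, ?_⟩
    · intro X Y Z
      apply Monad.Algebra.Hom.ext
      change (𝟙 X.A ⊗ₘ (0 : Y.A ⟶ Z.A)) = 0
      simp
    · intro X Y Z
      apply Monad.Algebra.Hom.ext
      change ((0 : Y.A ⟶ Z.A) ⊗ₘ 𝟙 X.A) = 0
      simp
    · intro X Y Z f g
      apply Monad.Algebra.Hom.ext
      change (𝟙 X.A ⊗ₘ (f.f + g.f)) = (𝟙 X.A ⊗ₘ f.f) + (𝟙 X.A ⊗ₘ g.f)
      simp
    · intro X Y Z f g
      apply Monad.Algebra.Hom.ext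
      change ((f.f + g.f) ⊗ₘ 𝟙 X.A) = (f.f ⊗ₘ 𝟙 X.A) + (g.f ⊗ₘ 𝟙 X.A)
      simp
  have hml : MonoidalLinear ℂ h.Mod := by
    refine ⟨?_, ?_⟩
    · intro X Y Z r f
      apply Monad.Algebra.Hom.ext
      change (𝟙 X.A ⊗ₘ (r • f.f)) = r • (𝟙 X.A ⊗ₘ f.f)
      simp
    · intro r Y Z f X
      apply Monad.Algebra.Hom.ext
      change ((r • f.f) ⊗ₘ 𝟙 X.A) = r • (f.f ⊗ₘ 𝟙 X.A)
      simp
  refine ⟨⟨hab, hpre, hml, ?_, hfin, hdec, ?_, ?_⟩, ⟨inferInstance, hlin, inferInstance, ‹_›, ‹_›⟩⟩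
  · have : Nonempty (RigidCategory C) := IsFusionCategory.rigid
    exact this.elim fun _ => h.nonempty_rigidCategory hss
  · obtain ⟨n, S, hS⟩ := IsFusionCategory.finite_simples (C := C)
    refine finite_simples_of_exists_abelian hab hdec (fun k => h.toMonad.free.obj (S k))
      fun M hM => ?_
    have hid : 𝟙 M.A ≠ 0 := fun h0 => id_nonzero M (Monad.Algebra.Hom.ext h0)
    obtain ⟨m, ⟨d⟩⟩ := HasSimpleDecomposition.exists_decomposition
      (IsFusionCategory.semisimple M.A)
    obtain ⟨j⟩ : Nonempty (Fin m) := by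
      by_contra hemp
      rw [not_nonempty_iff] at hemp
      exact hid (by rw [← d.total]; simp)
    obtain ⟨k, ⟨e⟩⟩ := hS _ (d.simple j)
    -- The transpose of a nonzero map from a simple object into the underlying object of `M`.
    refine ⟨k, (h.toMonad.adj.homEquiv _ _).symm (e.inv ≫ d.i j), fun h0 => ?_⟩
    have h1 : e.inv ≫ d.i j = 0 := by
      have h2 := congrArg (h.toMonad.adj.homEquiv _ _) h0
      rw [Equiv.apply_symm_apply, Adjunction.homEquiv_unit, Functor.map_zero, comp_zero] at h2
      exact h2
    have := d.simple j
    apply id_nonzero (d.S j)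
    rw [← d.i_p_self j, ← e.hom_inv_id_assoc (d.i j), h1]
    simp
  -- Endomorphisms of the unit module embed in those of the unit of `C`, which bounds the dimension
  -- by one; the identity is nonzero, which bounds it below.
  · apply le_antisymm
    · have := LinearMap.finrank_le_finrank_of_injective
        (f := (h.forget.mapLinearMap ℂ : (𝟙_ h.Mod ⟶ 𝟙_ h.Mod) →ₗ[ℂ] (𝟙_ C ⟶ 𝟙_ C)))
        h.forget.map_injective
      exact this.trans (IsFusionCategory.finrank_end_unit (C := C)).le
    · rw [Nat.one_le_iff_ne_zero, ← Nat.pos_iff_ne_zero, Module.finrank_pos_iff]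
      refine ⟨𝟙 _, 0, fun h0 => ?_⟩
      have h1 : 𝟙 (𝟙_ C) = 0 := congrArg Monad.Algebra.Hom.f h0
      have h2 : Subsingleton (𝟙_ C ⟶ 𝟙_ C) :=
        ⟨fun a b => by rw [← Category.comp_id a, ← Category.comp_id b, h1]; simp⟩
      have h3 := IsFusionCategory.finrank_end_unit (C := C)
      rw [Module.finrank_zero_of_subsingleton] at h3
      exact zero_ne_one h3

end HopfMonad

/-! ### From opmonoidal monads to Hopf monads. -/

section Construction

variable {C : Type u₁} [Category.{v₁} C] [MonoidalCategory C]

local notation "δ" => Functor.OplaxMonoidal.δ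

/-- A monad structure on an opmonoidal endofunctor whose unit and multiplication are opmonoidal and
whose left fusion operator is invertible. -/
structure FusionMonad (T : C ⥤ C) [T.OplaxMonoidal] where
  /-- the unit -/
  unit : 𝟭 C ⟶ T
  /-- the multiplication -/
  mult : ∀ X, T.obj (T.obj X) ⟶ T.obj X
  mult_nat : ∀ {X Y : C} (f : X ⟶ Y), T.map (T.map f) ≫ mult Y = mult X ≫ T.map f
  map_unit_mult : ∀ X, T.map (unit.app X) ≫ mult X = 𝟙 _
  unit_mult : ∀ X, unit.app (T.obj X) ≫ mult X = 𝟙 _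
  mult_assoc : ∀ X, T.map (mult X) ≫ mult X = mult (T.obj X) ≫ mult X
  unit_δ : ∀ X Y, unit.app (X ⊗ Y) ≫ δ T X Y = unit.app X ⊗ₘ unit.app Y
  unit_η : unit.app (𝟙_ C) ≫ Functor.OplaxMonoidal.η T = 𝟙 _
  mult_δ : ∀ X Y, mult (X ⊗ Y) ≫ δ T X Y =
    T.map (δ T X Y) ≫ δ T (T.obj X) (T.obj Y) ≫ (mult X ⊗ₘ mult Y)
  mult_η : mult (𝟙_ C) ≫ Functor.OplaxMonoidal.η T =
    T.map (Functor.OplaxMonoidal.η T) ≫ Functor.OplaxMonoidal.η T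
  isIso_fusion : ∀ X Y, IsIso (δ T X (T.obj Y) ≫ T.obj X ◁ mult Y)

namespace FusionMonad

variable {T : C ⥤ C} [T.OplaxMonoidal] (m : FusionMonad T)

/-- Counitality of `δ` collapses the fusion operator at the unit object to the multiplication, so
`LeftHopfMonad.mul` gives back `mult`. -/
lemma mult_unitor (X : C) : T.map (λ_ (T.obj X)).inv ≫
    (δ T (𝟙_ C) (T.obj X) ≫ T.obj (𝟙_ C) ◁ m.mult X) ≫
      Functor.OplaxMonoidal.η T ▷ T.obj X ≫ (λ_ (T.obj X)).hom = m.mult X := by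
  have h1 : T.map (λ_ (T.obj X)).inv ≫ δ T (𝟙_ C) (T.obj X) ≫
      Functor.OplaxMonoidal.η T ▷ T.obj (T.obj X) ≫ (λ_ (T.obj (T.obj X))).hom = 𝟙 _ := by
    rw [Functor.OplaxMonoidal.left_unitality_hom, ← T.map_comp, Iso.inv_hom_id, T.map_id]
  rw [Category.assoc, whisker_exchange_assoc]
  have h2 : (𝟙_ C) ◁ m.mult X ≫ (λ_ (T.obj X)).hom =
      (λ_ (T.obj (T.obj X))).hom ≫ m.mult X := leftUnitor_naturality _
  rw [h2, reassoc_of% h1]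

/-- The left Hopf monad attached to an opmonoidal monad with invertible left fusion operator. -/
noncomputable def toLeftHopfMonad : LeftHopfMonad T where
  H X Y := @asIso _ _ _ _ _ (m.isIso_fusion X Y)
  η := m.unit
  T₀ := Functor.OplaxMonoidal.η T
  H_naturality {X X' Y Y'} f g := by
    have h1 : T.map (T.map g) ≫ m.mult Y' = m.mult Y ≫ T.map g := m.mult_nat g
    simp only [asIso_hom, Category.assoc]
    rw [← Functor.OplaxMonoidal.δ_natural_assoc, tensorHom_comp_whiskerLeft, h1,
      whiskerLeft_comp_tensorHom]
  η_H X Y := by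
    have h1 : m.unit.app (T.obj Y) ≫ m.mult Y = 𝟙 _ := m.unit_mult Y
    simp only [asIso_hom]
    rw [reassoc_of% m.unit_δ, tensorHom_comp_whiskerLeft]
    erw [h1]
    simp
  η_T₀ := m.unit_η
  H_T₀_right X := by
    simp only [asIso_hom, Category.assoc]
    rw [← whiskerLeft_comp_assoc, m.mult_η, whiskerLeft_comp_assoc,
      Functor.OplaxMonoidal.δ_natural_right_assoc, Functor.OplaxMonoidal.right_unitality_hom,
      T.map_comp]
  H_T₀_left X := by
    simp only [asIso_hom]
    have := m.mult_unitor X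
    rw [Category.assoc] at this
    rw [Category.assoc, this, m.map_unit_mult]
    rfl
  heptagon X Y Z := by
    -- The heptagon splits into compatibility of the multiplication with `δ` together with its
    -- associativity (`h1`), coassociativity of `δ` (`h2`) and interchange (`h3`).
    have h1 : m.mult (Y ⊗ T.obj Z) ≫ δ T Y (T.obj Z) ≫ T.obj Y ◁ m.mult Z =
        T.map (δ T Y (T.obj Z) ≫ T.obj Y ◁ m.mult Z) ≫ δ T (T.obj Y) (T.obj Z) ≫
          (m.mult Y ⊗ₘ m.mult Z) := by
      rw [reassoc_of% m.mult_δ, tensorHom_comp_whiskerLeft, ← m.mult_assoc,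
        ← whiskerLeft_comp_tensorHom, Functor.OplaxMonoidal.δ_natural_right_assoc,
        T.map_comp_assoc]
    have h2 : T.map (α_ X (T.obj Y) (T.obj Z)).inv ≫ δ T (X ⊗ T.obj Y) (T.obj Z) ≫
        δ T X (T.obj Y) ▷ T.obj (T.obj Z) ≫
          (α_ (T.obj X) (T.obj (T.obj Y)) (T.obj (T.obj Z))).hom =
        δ T X (T.obj Y ⊗ T.obj Z) ≫ T.obj X ◁ δ T (T.obj Y) (T.obj Z) := by
      rw [Functor.OplaxMonoidal.associativity, ← T.map_comp_assoc, Iso.inv_hom_id, T.map_id,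
        Category.id_comp]
    have h3 : T.obj (X ⊗ T.obj Y) ◁ m.mult Z ≫
        (δ T X (T.obj Y) ≫ T.obj X ◁ m.mult Y) ▷ T.obj Z ≫
          (α_ (T.obj X) (T.obj Y) (T.obj Z)).hom =
        δ T X (T.obj Y) ▷ T.obj (T.obj Z) ≫
          (α_ (T.obj X) (T.obj (T.obj Y)) (T.obj (T.obj Z))).hom ≫
            T.obj X ◁ (m.mult Y ⊗ₘ m.mult Z) := by
      rw [whisker_exchange_assoc, comp_whiskerRight_assoc, MonoidalCategory.tensorHom_def,
        whiskerLeft_comp, ← associator_naturality_middle_assoc, associator_naturality_right]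
    simp only [asIso_hom, Category.assoc]
    rw [← whiskerLeft_comp, h1, whiskerLeft_comp (T.obj X) (T.map _),
      Functor.OplaxMonoidal.δ_natural_right_assoc, h3, reassoc_of% h2, whiskerLeft_comp (T.obj X) (δ T _ _)]

lemma toLeftHopfMonad_mul (X : C) : m.toLeftHopfMonad.mul X = m.mult X := m.mult_unitor X

lemma toLeftHopfMonad_comul (X Y : C) : m.toLeftHopfMonad.comul X Y = δ T X Y := by
  change T.map (X ◁ m.unit.app Y) ≫ δ T X (T.obj Y) ≫ T.obj X ◁ m.mult Y = δ T X Y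
  have h1 := Functor.OplaxMonoidal.δ_natural_right T X (m.unit.app Y)
  have h2 : T.map (m.unit.app Y) ≫ m.mult Y = 𝟙 (T.obj Y) := m.map_unit_mult Y
  refine (Category.assoc _ _ _).symm.trans ((congrArg (· ≫ _) h1.symm).trans ?_)
  refine (Category.assoc _ _ _).trans ?_
  refine (congrArg (_ ≫ ·) ((whiskerLeft_comp _ _ _).symm.trans
    (congrArg (T.obj X ◁ ·) h2))).trans ?_
  simp

end FusionMonad

end Construction

/-! ### Strong monoidal functors and duals. -/

section Comonoidal

variable {C : Type u₁} [Category.{v₁} C] [MonoidalCategory C] {F : Type u₂} [Category.{v₂} F]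
  [MonoidalCategory F]

/-- The image of an exact pairing under a strong monoidal functor. -/
@[reducible]
def exactPairingMap (ρ : F ⥤ C) [ρ.Monoidal] (Y D : F) [ExactPairing Y D] :
    ExactPairing (ρ.obj Y) (ρ.obj D) where
  coevaluation' := Functor.LaxMonoidal.ε ρ ≫ ρ.map (η_ Y D) ≫ Functor.OplaxMonoidal.δ ρ Y D
  evaluation' := Functor.LaxMonoidal.μ ρ D Y ≫ ρ.map (ε_ Y D) ≫ Functor.OplaxMonoidal.η ρ
  coevaluation_evaluation' := by
    have h := congrArg ρ.map (ExactPairing.coevaluation_evaluation Y D)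
    simp only [ρ.map_comp, Functor.Monoidal.map_whiskerLeft, Functor.Monoidal.map_whiskerRight,
      Functor.Monoidal.map_associator_inv, Functor.Monoidal.map_rightUnitor,
      Functor.Monoidal.map_leftUnitor_inv, Category.assoc, Functor.Monoidal.μ_δ_assoc] at h
    -- The image of the zigzag identity lives on `ρ` of tensor products; composing with the
    -- structure isomorphisms on both ends moves it to tensor products of images.
    have h' := Functor.LaxMonoidal.μ ρ D (𝟙_ F) ≫= h =≫ Functor.OplaxMonoidal.δ ρ (𝟙_ F) D
    have h'' := ρ.obj D ◁ Functor.LaxMonoidal.ε ρ ≫= h' =≫ Functor.OplaxMonoidal.η ρ ▷ ρ.obj D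
    simp only [Category.assoc, Functor.Monoidal.μ_δ_assoc, Functor.Monoidal.μ_δ,
      Category.comp_id, Functor.Monoidal.whiskerLeft_ε_η_assoc,
      Functor.Monoidal.whiskerRight_ε_η] at h''
    simpa only [whiskerLeft_comp, comp_whiskerRight, Category.assoc] using h''
  evaluation_coevaluation' := by
    have h := congrArg ρ.map (ExactPairing.evaluation_coevaluation Y D)
    simp only [ρ.map_comp, Functor.Monoidal.map_whiskerLeft, Functor.Monoidal.map_whiskerRight,
      Functor.Monoidal.map_associator, Functor.Monoidal.map_leftUnitor,
      Functor.Monoidal.map_rightUnitor_inv, Category.assoc, Functor.Monoidal.μ_δ_assoc] at h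
    have h' := Functor.LaxMonoidal.μ ρ (𝟙_ F) Y ≫= h =≫ Functor.OplaxMonoidal.δ ρ Y (𝟙_ F)
    have h'' := Functor.LaxMonoidal.ε ρ ▷ ρ.obj Y ≫= h' =≫ ρ.obj Y ◁ Functor.OplaxMonoidal.η ρ
    simp only [Category.assoc, Functor.Monoidal.μ_δ_assoc, Functor.Monoidal.μ_δ,
      Category.comp_id, Functor.Monoidal.whiskerRight_ε_η_assoc,
      Functor.Monoidal.whiskerLeft_ε_η] at h''
    simpa only [whiskerLeft_comp, comp_whiskerRight, Category.assoc] using h''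

/-- A strong monoidal functor is compatible with transposition along exact pairings. -/
lemma tensorRightHomEquiv_map (ρ : F ⥤ C) [ρ.Monoidal] (Y D : F) [ExactPairing Y D] {A Z : F}
    (g : A ⊗ Y ⟶ Z) :
    letI := exactPairingMap ρ Y D
    tensorRightHomEquiv (ρ.obj A) (ρ.obj Y) (ρ.obj D) (ρ.obj Z)
      (Functor.LaxMonoidal.μ ρ A Y ≫ ρ.map g) ≫ Functor.LaxMonoidal.μ ρ Z D =
      ρ.map (tensorRightHomEquiv A Y D Z g) := by
  change ((ρ_ (ρ.obj A)).inv ≫ ρ.obj A ◁ (Functor.LaxMonoidal.ε ρ ≫ ρ.map (η_ Y D) ≫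
    Functor.OplaxMonoidal.δ ρ Y D) ≫ (α_ _ _ _).inv ≫ (Functor.LaxMonoidal.μ ρ A Y ≫ ρ.map g) ▷
    ρ.obj D) ≫ Functor.LaxMonoidal.μ ρ Z D =
    ρ.map ((ρ_ _).inv ≫ _ ◁ η_ _ _ ≫ (α_ _ _ _).inv ≫ g ▷ _)
  simp only [ρ.map_comp, Functor.Monoidal.map_whiskerLeft, Functor.Monoidal.map_whiskerRight,
    Functor.Monoidal.map_associator_inv, Functor.Monoidal.map_rightUnitor_inv, whiskerLeft_comp, comp_whiskerRight,
    Category.assoc, Functor.Monoidal.μ_δ_assoc]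

/-- A strong monoidal functor is compatible with transposition along exact pairings. -/
lemma tensorLeftHomEquiv_map (ρ : F ⥤ C) [ρ.Monoidal] (Y D : F) [ExactPairing D Y] {A Z : F}
    (g : Y ⊗ A ⟶ Z) :
    letI := exactPairingMap ρ D Y
    tensorLeftHomEquiv (ρ.obj A) (ρ.obj D) (ρ.obj Y) (ρ.obj Z)
      (Functor.LaxMonoidal.μ ρ Y A ≫ ρ.map g) ≫ Functor.LaxMonoidal.μ ρ D Z =
      ρ.map (tensorLeftHomEquiv A D Y Z g) := by
  change ((λ_ (ρ.obj A)).inv ≫ (Functor.LaxMonoidal.ε ρ ≫ ρ.map (η_ D Y) ≫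
    Functor.OplaxMonoidal.δ ρ D Y) ▷ ρ.obj A ≫ (α_ _ _ _).hom ≫
    ρ.obj D ◁ (Functor.LaxMonoidal.μ ρ Y A ≫ ρ.map g)) ≫ Functor.LaxMonoidal.μ ρ D Z =
    ρ.map ((λ_ _).inv ≫ η_ _ _ ▷ _ ≫ (α_ _ _ _).hom ≫ _ ◁ g)
  simp only [ρ.map_comp, Functor.Monoidal.map_whiskerLeft, Functor.Monoidal.map_whiskerRight,
    Functor.Monoidal.map_associator, Functor.Monoidal.map_leftUnitor_inv, whiskerLeft_comp, comp_whiskerRight,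
    Category.assoc, Functor.Monoidal.μ_δ_assoc]

end Comonoidal

/-! ### The projection formula and the induced Hopf monad. -/

section Projection

variable {C : Type u₁} [Category.{v₁} C] [MonoidalCategory C] {F : Type u₂} [Category.{v₂} F]
  [MonoidalCategory F] {G : C ⥤ F} {ρ : F ⥤ C} [ρ.Monoidal] [G.OplaxMonoidal] (adj : G ⊣ ρ)

omit [MonoidalCategory F] in
/-- A morphism is invertible if precomposition with it is bijective. -/
lemma isIso_of_bijective_precomp {A B : F} (φ : A ⟶ B)
    (hφ : ∀ Z : F, Function.Bijective fun g : B ⟶ Z => φ ≫ g) : IsIso φ := by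
  obtain ⟨ψ, hψ⟩ := (hφ A).2 (𝟙 A)
  refine ⟨ψ, hψ, (hφ B).1 ?_⟩
  change φ ≫ ψ ≫ φ = φ ≫ 𝟙 B
  have hψ' : φ ≫ ψ = 𝟙 A := hψ
  rw [reassoc_of% hψ', Category.comp_id]

/-- The left projection morphism `G (X ⊗ ρ Y) ⟶ G X ⊗ Y`. -/
def projectionLeft (X : C) (Y : F) : G.obj (X ⊗ ρ.obj Y) ⟶ G.obj X ⊗ Y :=
  Functor.OplaxMonoidal.δ G X (ρ.obj Y) ≫ G.obj X ◁ adj.counit.app Y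

/-- The right projection morphism `G (ρ Y ⊗ X) ⟶ Y ⊗ G X`. -/
def projectionRight (Y : F) (X : C) : G.obj (ρ.obj Y ⊗ X) ⟶ Y ⊗ G.obj X :=
  Functor.OplaxMonoidal.δ G (ρ.obj Y) X ≫ adj.counit.app Y ▷ G.obj X

variable [adj.IsMonoidal]

/-- The unit of the adjunction is comonoidal, and a triangle identity then cancels the counit at
`Y`. -/
lemma homEquiv_projectionLeft (X : C) (Y : F) :
    adj.homEquiv _ _ (projectionLeft adj X Y) =
      adj.unit.app X ▷ ρ.obj Y ≫ Functor.LaxMonoidal.μ ρ (G.obj X) Y := by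
  rw [adj.homEquiv_unit, projectionLeft, ρ.map_comp]
  have h1 := adj.unit_app_tensor_comp_map_δ X (ρ.obj Y)
  have h2 := adj.right_triangle_components Y
  dsimp only [Functor.id_obj, Functor.comp_obj] at h1 h2 ⊢
  rw [reassoc_of% h1, ← Functor.LaxMonoidal.μ_natural_right, tensorHom_comp_whiskerLeft_assoc, h2,
    tensorHom_id]

lemma homEquiv_projectionRight (Y : F) (X : C) :
    adj.homEquiv _ _ (projectionRight adj Y X) =
      ρ.obj Y ◁ adj.unit.app X ≫ Functor.LaxMonoidal.μ ρ Y (G.obj X) := by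
  rw [adj.homEquiv_unit, projectionRight, ρ.map_comp]
  have h1 := adj.unit_app_tensor_comp_map_δ (ρ.obj Y) X
  have h2 := adj.right_triangle_components Y
  dsimp only [Functor.id_obj, Functor.comp_obj] at h1 h2 ⊢
  rw [reassoc_of% h1, ← Functor.LaxMonoidal.μ_natural_left, tensorHom_comp_whiskerRight_assoc, h2,
    id_tensorHom]

/-- By Yoneda: maps `G X ⊗ Y ⟶ Z` are maps `G X ⟶ Z ⊗ D`, hence maps `X ⟶ ρ Z ⊗ ρ D`, hence maps `X
⊗ ρ Y ⟶ ρ Z`, hence maps `G (X ⊗ ρ Y) ⟶ Z`. The composite bijection is precomposition with the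
projection morphism, because `ρ` respects transposition. -/
lemma isIso_projectionLeft (X : C) (Y D : F) [ExactPairing Y D] :
    IsIso (projectionLeft adj X Y) := by
  apply isIso_of_bijective_precomp
  intro Z
  let _ := exactPairingMap ρ Y D
  let e₁ := (tensorRightHomEquiv (G.obj X) Y D Z).trans (adj.homEquiv X (Z ⊗ D))
  let e₂ := (adj.homEquiv (X ⊗ ρ.obj Y) Z).trans
    ((tensorRightHomEquiv X (ρ.obj Y) (ρ.obj D) (ρ.obj Z)).trans
      (Functor.Monoidal.μIso ρ Z D).homToEquiv)
  have h : ∀ g, e₂ (projectionLeft adj X Y ≫ g) = e₁ g := by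
    intro g
    change tensorRightHomEquiv X (ρ.obj Y) (ρ.obj D) (ρ.obj Z)
      (adj.homEquiv _ _ (projectionLeft adj X Y ≫ g)) ≫ Functor.LaxMonoidal.μ ρ Z D =
      adj.homEquiv X (Z ⊗ D) (tensorRightHomEquiv (G.obj X) Y D Z g)
    have h1 : ∀ k : ρ.obj (G.obj X) ⊗ ρ.obj Y ⟶ ρ.obj Z,
        tensorRightHomEquiv X (ρ.obj Y) (ρ.obj D) (ρ.obj Z) (adj.unit.app X ▷ ρ.obj Y ≫ k) =
          adj.unit.app X ≫ tensorRightHomEquiv _ (ρ.obj Y) (ρ.obj D) (ρ.obj Z) k := by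
      intro k
      rw [← Equiv.eq_symm_apply, tensorRightHomEquiv_symm_naturality, Equiv.symm_apply_apply]
    rw [adj.homEquiv_naturality_right, homEquiv_projectionLeft, Category.assoc, h1,
      Category.assoc, adj.homEquiv_unit]
    exact congrArg (adj.unit.app X ≫ ·) (tensorRightHomEquiv_map ρ Y D g)
  have : (fun g => projectionLeft adj X Y ≫ g) = e₂.symm ∘ e₁ := by
    funext g
    rw [Function.comp_apply, ← h, Equiv.symm_apply_apply]
  rw [this]
  exact e₂.symm.bijective.comp e₁.bijective

lemma isIso_projectionRight (X : C) (Y D : F) [ExactPairing D Y] :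
    IsIso (projectionRight adj Y X) := by
  apply isIso_of_bijective_precomp
  intro Z
  let _ := exactPairingMap ρ D Y
  let e₁ := (tensorLeftHomEquiv (G.obj X) D Y Z).trans (adj.homEquiv X (D ⊗ Z))
  let e₂ := (adj.homEquiv (ρ.obj Y ⊗ X) Z).trans
    ((tensorLeftHomEquiv X (ρ.obj D) (ρ.obj Y) (ρ.obj Z)).trans
      (Functor.Monoidal.μIso ρ D Z).homToEquiv)
  have h : ∀ g, e₂ (projectionRight adj Y X ≫ g) = e₁ g := by
    intro g
    change tensorLeftHomEquiv X (ρ.obj D) (ρ.obj Y) (ρ.obj Z)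
      (adj.homEquiv _ _ (projectionRight adj Y X ≫ g)) ≫ Functor.LaxMonoidal.μ ρ D Z =
      adj.homEquiv X (D ⊗ Z) (tensorLeftHomEquiv (G.obj X) D Y Z g)
    have h1 : ∀ k : ρ.obj Y ⊗ ρ.obj (G.obj X) ⟶ ρ.obj Z,
        tensorLeftHomEquiv X (ρ.obj D) (ρ.obj Y) (ρ.obj Z) (ρ.obj Y ◁ adj.unit.app X ≫ k) =
          adj.unit.app X ≫ tensorLeftHomEquiv _ (ρ.obj D) (ρ.obj Y) (ρ.obj Z) k := by
      intro k
      rw [← Equiv.eq_symm_apply, tensorLeftHomEquiv_symm_naturality, Equiv.symm_apply_apply]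
    rw [adj.homEquiv_naturality_right, homEquiv_projectionRight, Category.assoc, h1,
      Category.assoc, adj.homEquiv_unit]
    exact congrArg (adj.unit.app X ≫ ·) (tensorLeftHomEquiv_map ρ Y D g)
  have : (fun g => projectionRight adj Y X ≫ g) = e₂.symm ∘ e₁ := by
    funext g
    rw [Function.comp_apply, ← h, Equiv.symm_apply_apply]
  rw [this]
  exact e₂.symm.bijective.comp e₁.bijective

/-- The opmonoidal monad of an adjunction with strong monoidal right adjoint. -/
def _root_.CategoryTheory.Adjunction.fusionMonad
    (hY : ∀ (X : C) (Y : F), IsIso (projectionLeft adj X Y)) : FusionMonad (G ⋙ ρ) where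
  unit := adj.unit
  mult X := ρ.map (adj.counit.app (G.obj X))
  mult_nat f := by
    have h := adj.counit_naturality (G.map f)
    change ρ.map (G.map (ρ.map (G.map f))) ≫ _ = _ ≫ ρ.map (G.map f)
    rw [← ρ.map_comp, ← ρ.map_comp]
    exact congrArg ρ.map h
  map_unit_mult X := by
    change ρ.map (G.map (adj.unit.app X)) ≫ _ = _
    rw [← ρ.map_comp]
    exact (congrArg ρ.map (adj.left_triangle_components X)).trans (ρ.map_id _)
  unit_mult X := adj.right_triangle_components (G.obj X)
  mult_assoc X := by
    change ρ.map (G.map (ρ.map _)) ≫ _ = _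
    rw [← ρ.map_comp]
    exact (congrArg ρ.map (adj.counit_naturality (adj.counit.app (G.obj X)))).trans (ρ.map_comp _ _)
  unit_δ X Y := by
    have h1 := adj.unit_app_tensor_comp_map_δ X Y
    rw [Functor.OplaxMonoidal.comp_δ]
    refine (Category.assoc _ _ _).symm.trans ((congrArg (· ≫ _) h1).trans ?_)
    simp
  unit_η := by
    have h1 := adj.unit_app_unit_comp_map_η
    rw [Functor.OplaxMonoidal.comp_η]
    refine (Category.assoc _ _ _).symm.trans ((congrArg (· ≫ _) h1).trans ?_)
    simp
  mult_δ X Y := by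
    rw [Functor.OplaxMonoidal.comp_δ, Functor.OplaxMonoidal.comp_δ]
    have h1 := adj.map_μ_comp_counit_app_tensor (G.obj X) (G.obj Y)
    have h2 := adj.counit_naturality (Functor.OplaxMonoidal.δ G X Y)
    dsimp only [Functor.comp_obj, Functor.comp_map, Functor.id_obj] at h1 h2 ⊢
    -- The counit is comonoidal; naturality of the counit at `δ` of `G` finishes the computation.
    have h3 : ρ.map (G.map (Functor.OplaxMonoidal.δ ρ (G.obj X) (G.obj Y))) ≫
        ρ.map (Functor.OplaxMonoidal.δ G (ρ.obj (G.obj X)) (ρ.obj (G.obj Y))) ≫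
          ρ.map (adj.counit.app (G.obj X) ⊗ₘ adj.counit.app (G.obj Y)) =
        ρ.map (adj.counit.app (G.obj X ⊗ G.obj Y)) := by
      rw [← ρ.map_comp, ← ρ.map_comp, ← h1, ← G.map_comp_assoc, Functor.Monoidal.δ_μ, G.map_id,
        Category.id_comp]
    rw [Category.assoc, Functor.OplaxMonoidal.δ_natural, G.map_comp, ρ.map_comp, Category.assoc,
      reassoc_of% h3, ← ρ.map_comp_assoc, ← ρ.map_comp_assoc, h2]
  mult_η := by
    rw [Functor.OplaxMonoidal.comp_η]
    have h1 := adj.map_ε_comp_counit_app_unit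
    have h2 := adj.counit_naturality (Functor.OplaxMonoidal.η G)
    dsimp only [Functor.comp_obj, Functor.comp_map, Functor.id_obj] at h1 h2 ⊢
    have h3 : ρ.map (G.map (Functor.OplaxMonoidal.η ρ)) ≫ ρ.map (Functor.OplaxMonoidal.η G) =
        ρ.map (adj.counit.app (𝟙_ F)) := by
      rw [← ρ.map_comp, ← h1, ← G.map_comp_assoc, Functor.Monoidal.η_ε, G.map_id,
        Category.id_comp]
    rw [G.map_comp, ρ.map_comp, Category.assoc, reassoc_of% h3, ← ρ.map_comp_assoc,
      ← ρ.map_comp_assoc, h2]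
  isIso_fusion X Y := by
    -- The fusion operator is `ρ` of the projection morphism, up to the structure isomorphism of
    -- `ρ`.
    have h1 : Functor.OplaxMonoidal.δ (G ⋙ ρ) X ((G ⋙ ρ).obj Y) ≫
        (G ⋙ ρ).obj X ◁ ρ.map (adj.counit.app (G.obj Y)) =
        ρ.map (projectionLeft adj X (G.obj Y)) ≫ Functor.OplaxMonoidal.δ ρ _ _ := by
      rw [Functor.OplaxMonoidal.comp_δ, projectionLeft, ρ.map_comp, Category.assoc, Category.assoc]
      exact congrArg (_ ≫ ·) (Functor.OplaxMonoidal.δ_natural_right ρ (G.obj X) _)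
    rw [h1]
    have := hY X (G.obj Y)
    infer_instance

/-- The Hopf monad of an adjunction with strong monoidal right adjoint whose projection morphisms
are invertible. -/
noncomputable def _root_.CategoryTheory.Adjunction.hopfMonad
    (hY : ∀ (X : C) (Y : F), IsIso (projectionLeft adj X Y))
    (hY' : ∀ (Y : F) (X : C), IsIso (projectionRight adj Y X)) : HopfMonad (G ⋙ ρ) where
  toLeftHopfMonad := (adj.fusionMonad hY).toLeftHopfMonad
  isIso_rightFusion X Y := by
    have h1 : (adj.fusionMonad hY).toLeftHopfMonad.rightFusion X Y =
        ρ.map (projectionRight adj (G.obj X) Y) ≫ Functor.OplaxMonoidal.δ ρ _ _ := by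
      rw [LeftHopfMonad.rightFusion, FusionMonad.toLeftHopfMonad_comul,
        FusionMonad.toLeftHopfMonad_mul, Functor.OplaxMonoidal.comp_δ, projectionRight,
        ρ.map_comp, Category.assoc, Category.assoc]
      exact congrArg (_ ≫ ·) (Functor.OplaxMonoidal.δ_natural_left ρ _ (G.obj Y))
    rw [h1]
    have := hY' (G.obj X) Y
    infer_instance

end Projection

section Induced

variable {C : Type u₁} [Category.{v₁} C] [MonoidalCategory C] {F : Type u₂} [Category.{v₂} F]
  [MonoidalCategory F] {G : C ⥤ F} {ρ : F ⥤ C} [ρ.Monoidal] (adj : G ⊣ ρ)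

/-- A strong monoidal functor out of a rigid category which has a left adjoint induces a Hopf
monad. -/
lemma exists_hopfMonad_isInducedBy [RigidCategory F] :
    ∃ h : HopfMonad (G ⋙ ρ), h.IsInducedBy adj := by
  -- By definition the mate of the monoidal structure of `ρ`, so the conditions on `T₂` and `T₀` in
  -- `IsInducedBy` need only unfolding.
  let _ := adj.leftAdjointOplaxMonoidal
  let m := adj.fusionMonad fun X Y => isIso_projectionLeft adj X Y Yᘁ
  refine ⟨adj.hopfMonad (fun X Y => isIso_projectionLeft adj X Y Yᘁ)
    (fun Y X => isIso_projectionRight adj X Y (HasLeftDual.leftDual Y)), rfl, fun X => ?_,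
    fun X Y => ?_, rfl⟩
  · exact m.toLeftHopfMonad_mul X
  · exact m.toLeftHopfMonad_comul X Y

end Induced

/-! ### Monadicity: the comparison functor is a monoidal equivalence. -/

/-- A morphism whose composite with a split epimorphism `ρ e` lifts along `ρ` itself lifts along
`ρ`. -/
lemma exists_map_eq_of_map_eq_comp {C : Type u₁} [Category.{v₁} C] [Preadditive C] {F : Type u₂}
    [Category.{v₂} F] [Abelian F] (ρ : F ⥤ C) [ρ.Faithful] [ρ.Additive] {W Y Z : F} (e : W ⟶ Y)
    [Epi e] (d : W ⟶ Z) (c : ρ.obj Y ⟶ ρ.obj Z) {s : ρ.obj Y ⟶ ρ.obj W}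
    (hs : s ≫ ρ.map e = 𝟙 _) (hd : ρ.map d = ρ.map e ≫ c) : ∃ g : Y ⟶ Z, ρ.map g = c := by
  -- Since `ρ` is faithful, vanishing of `d` on the kernel of `e` can be tested after `ρ`; hence `d`
  -- descends along the epimorphism `e`.
  have hk : kernel.ι e ≫ d = 0 := by
    apply ρ.map_injective
    rw [ρ.map_comp, hd, ← ρ.map_comp_assoc, kernel.condition, ρ.map_zero, ρ.map_zero, zero_comp]
  let S := ShortComplex.mk (kernel.ι e) e (kernel.condition _)
  have hS : S.Exact := ShortComplex.exact_of_f_is_kernel S (kernelIsKernel _)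
  have : Epi S.g := ‹Epi e›
  have hg : e ≫ hS.desc d hk = d := hS.g_desc _ hk
  refine ⟨hS.desc d hk, ?_⟩
  have h2 : ρ.map e ≫ ρ.map (hS.desc d hk) = ρ.map e ≫ c := by rw [← ρ.map_comp, hg, hd]
  calc ρ.map (hS.desc d hk) = (s ≫ ρ.map e) ≫ ρ.map (hS.desc d hk) := by
        rw [hs, Category.id_comp]
    _ = c := by rw [Category.assoc, h2, reassoc_of% hs]

/-- The coequalizer of a `ρ`-split pair is a coequalizer after applying `ρ`. -/
lemma exists_iso_map_of_isSplitCoequalizer {C : Type u₁} [Category.{v₁} C] [Abelian C]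
    {F : Type u₂} [Category.{v₂} F] [Abelian F] (ρ : F ⥤ C) [ρ.Additive]
    [PreservesFiniteColimits ρ] {W V : F} {A : C} (e d : W ⟶ V) (r : ρ.obj V ⟶ A)
    (s : A ⟶ ρ.obj V) (t : ρ.obj V ⟶ ρ.obj W) (hr : ρ.map e ≫ r = ρ.map d ≫ r)
    (hs : s ≫ r = 𝟙 A) (ht : t ≫ ρ.map e = 𝟙 _) (hd : t ≫ ρ.map d = r ≫ s) :
    ∃ (Q : F) (q : V ⟶ Q) (i : A ≅ ρ.obj Q), i.hom = s ≫ ρ.map q ∧ r ≫ i.hom = ρ.map q := by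
  have hq : d ≫ cokernel.π (d - e) = e ≫ cokernel.π (d - e) := by
    rw [← sub_eq_zero, ← Preadditive.sub_comp, cokernel.condition]
  have hρq : ρ.map d ≫ ρ.map (cokernel.π (d - e)) = ρ.map e ≫ ρ.map (cokernel.π (d - e)) := by
    rw [← ρ.map_comp, hq, ρ.map_comp]
  have hrφ : r ≫ s ≫ ρ.map (cokernel.π (d - e)) = ρ.map (cokernel.π (d - e)) := by
    rw [← reassoc_of% hd, hρq, reassoc_of% ht]
  have hcok : ρ.map (d - e) ≫ r = 0 := by
    rw [ρ.map_sub, Preadditive.sub_comp, hr, sub_self]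
  -- The inverse isomorphism: `ρ` preserves the cokernel of `d - e`, and `r` factors through it.
  let ψ : ρ.obj (cokernel (d - e)) ⟶ A := (PreservesCokernel.iso ρ _).hom ≫ cokernel.desc _ r hcok
  have hψ : ρ.map (cokernel.π (d - e)) ≫ ψ = r := by
    have h1 : ρ.map (cokernel.π (d - e)) ≫ (PreservesCokernel.iso ρ _).hom = cokernel.π _ :=
      PreservesCokernel.π_iso_hom ρ _
    rw [reassoc_of% h1, cokernel.π_desc]
  exact ⟨_, cokernel.π (d - e),
    { hom := s ≫ ρ.map (cokernel.π (d - e))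
      inv := ψ
      hom_inv_id := by rw [Category.assoc, hψ, hs]
      inv_hom_id := by
        rw [← cancel_epi (ρ.map (cokernel.π (d - e))), reassoc_of% hψ, hrφ, Category.comp_id] },
    rfl, hrφ⟩

namespace HopfMonad

section Comparison

variable {C : Type u₁} [Category.{v₁} C] [MonoidalCategory C] {F : Type u₂} [Category.{v₂} F]
  [MonoidalCategory F] {G : C ⥤ F} {ρ : F ⥤ C} [ρ.Monoidal] {adj : G ⊣ ρ}
  {h : HopfMonad (G ⋙ ρ)} (ind : h.IsInducedBy adj)

/-- The comparison functor from the source of the right adjoint to modules over the induced Hopf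
monad. -/
def comparison : F ⥤ h.Mod where
  obj Y :=
    { A := ρ.obj Y
      a := ρ.map (adj.counit.app Y)
      unit := by
        change h.η.app (ρ.obj Y) ≫ ρ.map (adj.counit.app Y) = 𝟙 (ρ.obj Y)
        rw [ind.η_eq]
        exact adj.right_triangle_components Y
      assoc := by
        change h.mul (ρ.obj Y) ≫ ρ.map (adj.counit.app Y) =
          ρ.map (G.map (ρ.map (adj.counit.app Y))) ≫ ρ.map (adj.counit.app Y)
        rw [ind.mul_eq, ← ρ.map_comp, ← ρ.map_comp]
        exact congrArg ρ.map (adj.counit_naturality (adj.counit.app Y)).symm }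
  map {Y Z} f :=
    { f := ρ.map f
      h := by
        change ρ.map (G.map (ρ.map f)) ≫ ρ.map (adj.counit.app Z) =
          ρ.map (adj.counit.app Y) ≫ ρ.map f
        rw [← ρ.map_comp, ← ρ.map_comp]
        exact congrArg ρ.map (adj.counit_naturality f) }
  map_id Y := Monad.Algebra.Hom.ext (ρ.map_id Y)
  map_comp f g := Monad.Algebra.Hom.ext (ρ.map_comp f g)

lemma IsInducedBy.T₀_comp_ε (ind : h.IsInducedBy adj) : h.T₀ ≫ Functor.LaxMonoidal.ε ρ =
    ρ.map (G.map (Functor.LaxMonoidal.ε ρ)) ≫ ρ.map (adj.counit.app (𝟙_ F)) := by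
  rw [ind.T₀_eq, Category.assoc, Functor.Monoidal.η_ε, Category.comp_id, ← ρ.map_comp,
    adj.homEquiv_counit]

/-- Says that the tensor constraint of `ρ` is a module map, so that it lifts to the comparison
functor. The reason is that the counit is compatible with the mate structure on `G`. -/
lemma IsInducedBy.comul_comp_μ (ind : h.IsInducedBy adj) (Y Z : F) :
    (h.comul (ρ.obj Y) (ρ.obj Z) ≫ (ρ.map (adj.counit.app Y) ⊗ₘ ρ.map (adj.counit.app Z))) ≫
      Functor.LaxMonoidal.μ ρ Y Z =
    ρ.map (G.map (Functor.LaxMonoidal.μ ρ Y Z)) ≫ ρ.map (adj.counit.app (Y ⊗ Z)) := by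
  let _ := adj.leftAdjointOplaxMonoidal
  have h1 : G.map (Functor.LaxMonoidal.μ ρ Y Z) ≫ adj.counit.app (Y ⊗ Z) =
      (adj.homEquiv (ρ.obj Y ⊗ ρ.obj Z) (G.obj (ρ.obj Y) ⊗ G.obj (ρ.obj Z))).symm
      ((adj.unit.app (ρ.obj Y) ⊗ₘ adj.unit.app (ρ.obj Z)) ≫ Functor.LaxMonoidal.μ ρ _ _) ≫
        (adj.counit.app Y ⊗ₘ adj.counit.app Z) := adj.map_μ_comp_counit_app_tensor Y Z
  have h2 {A B : F} (f : A ⟶ Y) (g : B ⟶ Z) : Functor.OplaxMonoidal.δ ρ A B ≫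
      (ρ.map f ⊗ₘ ρ.map g) ≫ Functor.LaxMonoidal.μ ρ Y Z = ρ.map (f ⊗ₘ g) := by
    rw [Functor.LaxMonoidal.μ_natural, Functor.Monoidal.δ_μ_assoc]
  rw [← ρ.map_comp, h1, ind.comul_eq, Category.assoc, Category.assoc, ρ.map_comp]
  exact congrArg _ (h2 (adj.counit.app Y) (adj.counit.app Z))

/-- The monoidal structure of the comparison functor is that of the right adjoint. -/
def comparisonCoreMonoidal : (comparison ind).CoreMonoidal where
  εIso := Monad.Algebra.isoMk (A := 𝟙_ h.Mod) (B := (comparison ind).obj (𝟙_ F))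
    (Functor.Monoidal.εIso ρ) ind.T₀_comp_ε.symm
  μIso Y Z := Monad.Algebra.isoMk (A := (comparison ind).obj Y ⊗ (comparison ind).obj Z)
    (B := (comparison ind).obj (Y ⊗ Z)) (Functor.Monoidal.μIso ρ Y Z) (ind.comul_comp_μ Y Z).symm
  μIso_hom_natural_left {X Y} f X' := by
    apply Monad.Algebra.Hom.ext
    change (ρ.map f ⊗ₘ 𝟙 (ρ.obj X')) ≫ Functor.LaxMonoidal.μ ρ Y X' =
      Functor.LaxMonoidal.μ ρ X X' ≫ ρ.map (f ▷ X')
    simp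
  μIso_hom_natural_right {X Y} X' f := by
    apply Monad.Algebra.Hom.ext
    change (𝟙 (ρ.obj X') ⊗ₘ ρ.map f) ≫ Functor.LaxMonoidal.μ ρ X' Y =
      Functor.LaxMonoidal.μ ρ X' X ≫ ρ.map (X' ◁ f)
    simp
  associativity X Y Z := by
    apply Monad.Algebra.Hom.ext
    change (Functor.LaxMonoidal.μ ρ X Y ⊗ₘ 𝟙 (ρ.obj Z)) ≫ Functor.LaxMonoidal.μ ρ (X ⊗ Y) Z ≫
      ρ.map (α_ X Y Z).hom = (α_ _ _ _).hom ≫ (𝟙 (ρ.obj X) ⊗ₘ Functor.LaxMonoidal.μ ρ Y Z) ≫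
        Functor.LaxMonoidal.μ ρ X (Y ⊗ Z)
    simp
  left_unitality X := by
    apply Monad.Algebra.Hom.ext
    change (λ_ (ρ.obj X)).hom = (Functor.LaxMonoidal.ε ρ ⊗ₘ 𝟙 (ρ.obj X)) ≫
      Functor.LaxMonoidal.μ ρ (𝟙_ F) X ≫ ρ.map (λ_ X).hom
    simp
  right_unitality X := by
    apply Monad.Algebra.Hom.ext
    change (ρ_ (ρ.obj X)).hom = (𝟙 (ρ.obj X) ⊗ₘ Functor.LaxMonoidal.ε ρ) ≫
      Functor.LaxMonoidal.μ ρ X (𝟙_ F) ≫ ρ.map (ρ_ X).hom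
    simp

/-- The comparison functor is a functor over the base. -/
def comparisonForget : comparison ind ⋙ h.forget ≅ ρ :=
  NatIso.ofComponents (fun Y => Iso.refl (ρ.obj Y)) fun _ =>
    (Category.comp_id _).trans (Category.id_comp _).symm

lemma comparisonForget_isMonoidal :
    letI := (comparisonCoreMonoidal ind).toMonoidal
    NatTrans.IsMonoidal (comparisonForget ind).hom := by
  let _ := (comparisonCoreMonoidal ind).toMonoidal
  refine ⟨?_, fun X Y => ?_⟩
  · change (𝟙 _ ≫ Functor.LaxMonoidal.ε ρ) ≫ 𝟙 _ = Functor.LaxMonoidal.ε ρ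
    simp
  · change (𝟙 _ ≫ Functor.LaxMonoidal.μ ρ X Y) ≫ 𝟙 _ =
      (𝟙 (ρ.obj X) ⊗ₘ 𝟙 (ρ.obj Y)) ≫ Functor.LaxMonoidal.μ ρ X Y
    simp

lemma comparison_faithful [ρ.Faithful] : (comparison ind).Faithful :=
  ⟨fun hfg => ρ.map_injective (congrArg Monad.Algebra.Hom.f hfg)⟩

end Comparison

section Abelian

variable {C : Type u₁} [Category.{v₁} C] [Abelian C] [MonoidalCategory C] {F : Type u₂}
  [Category.{v₂} F] [Abelian F] [MonoidalCategory F] {G : C ⥤ F} {ρ : F ⥤ C} [ρ.Monoidal]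
  {adj : G ⊣ ρ} {h : HopfMonad (G ⋙ ρ)} (ind : h.IsInducedBy adj) [ρ.Additive]

/-- Faithfulness of `ρ` makes the counit at `Y` an epimorphism, and `ρ` of it is split by the unit.
Linearity of a module map `c` says that `c` precomposed with `ρ` of the counit comes from the source
category, so `c` itself does. -/
lemma comparison_full [ρ.Faithful] : (comparison ind).Full := by
  refine ⟨fun {Y Z} f => ?_⟩
  let c : ρ.obj Y ⟶ ρ.obj Z := f.f
  let e : G.obj (ρ.obj Y) ⟶ Y := adj.counit.app Y
  let d : G.obj (ρ.obj Z) ⟶ Z := adj.counit.app Z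
  have he : Epi e := inferInstanceAs (Epi (adj.counit.app Y))
  have hc : ρ.map (G.map c) ≫ ρ.map d = ρ.map e ≫ c := f.h
  obtain ⟨g, hg⟩ := exists_map_eq_of_map_eq_comp ρ e (G.map c ≫ d) c
    (adj.right_triangle_components Y) ((ρ.map_comp _ _).trans hc)
  exact ⟨g, Monad.Algebra.Hom.ext hg⟩

/-- Beck's argument: a module with action `r` is the split coequalizer in `C` of the image under `ρ`
of the pair formed by `G r` and the counit. Right exactness of `ρ` identifies it with the image of
the coequalizer `Q` of that pair. -/
lemma comparison_essSurj [PreservesFiniteColimits ρ] : (comparison ind).EssSurj := by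
  refine ⟨fun M => ?_⟩
  let r : ρ.obj (G.obj M.A) ⟶ M.A := M.a
  let e : G.obj (ρ.obj (G.obj M.A)) ⟶ G.obj M.A := adj.counit.app (G.obj M.A)
  let s : M.A ⟶ ρ.obj (G.obj M.A) := adj.unit.app M.A
  let t : ρ.obj (G.obj M.A) ⟶ ρ.obj (G.obj (ρ.obj (G.obj M.A))) := adj.unit.app _
  have hs : s ≫ r = 𝟙 M.A := by
    have h1 : h.η.app M.A ≫ r = 𝟙 _ := M.unit
    rwa [ind.η_eq] at h1
  have hr : ρ.map e ≫ r = ρ.map (G.map r) ≫ r := by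
    have h1 : h.mul M.A ≫ r = ρ.map (G.map r) ≫ r := M.assoc
    rwa [ind.mul_eq] at h1
  have ht : t ≫ ρ.map e = 𝟙 _ := adj.right_triangle_components _
  have hnat : t ≫ ρ.map (G.map r) = r ≫ s := (adj.unit.naturality r).symm
  obtain ⟨Q, q, i, hi, hri⟩ := exists_iso_map_of_isSplitCoequalizer ρ e (G.map r) r s t hr hs ht hnat
  let d : G.obj (ρ.obj Q) ⟶ Q := adj.counit.app Q
  have hcounit : G.map (ρ.map q) ≫ d = e ≫ q := adj.counit_naturality q
  have htri : G.map s ≫ e = 𝟙 _ := adj.left_triangle_components M.A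
  refine ⟨Q, ⟨(Monad.Algebra.isoMk (A := M) (B := (comparison ind).obj Q) i ?_).symm⟩⟩
  change ρ.map (G.map i.hom) ≫ ρ.map d = r ≫ i.hom
  rw [hri, ← ρ.map_comp, hi, G.map_comp, Category.assoc, hcounit, reassoc_of% htri]

lemma comparison_isEquivalence [ρ.Faithful] [PreservesFiniteColimits ρ] : (comparison ind).IsEquivalence where
  faithful := comparison_faithful ind
  full := comparison_full ind
  essSurj := comparison_essSurj ind

/-- The induced Hopf monad is semisimple if epimorphisms split. -/
lemma IsInducedBy.isSemisimple [ρ.Faithful] (ind : h.IsInducedBy adj) [PreservesFiniteColimits ρ]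
    (hF : ∀ {X Y : F} (f : X ⟶ Y) [Epi f], IsSplitEpi f) : h.IsSemisimple := by
  intro M
  have := comparison_essSurj ind
  let Y := (comparison ind).objPreimage M
  let e : (comparison ind).obj Y ≅ M := (comparison ind).objObjPreimageIso M
  -- A section of the counit exhibits `Y` as a retract of `G ρ Y`, which the comparison functor
  -- sends to the free module on `ρ Y`.
  have := hF (adj.counit.app Y)
  let k : (comparison ind).obj (G.obj (ρ.obj Y)) ≅ h.toMonad.free.obj (ρ.obj Y) :=
    Monad.Algebra.isoMk (A := (comparison ind).obj (G.obj (ρ.obj Y)))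
      (B := h.toMonad.free.obj (ρ.obj Y)) (Iso.refl _) (by
        change ρ.map (G.map (𝟙 _)) ≫ h.mul (ρ.obj Y) = ρ.map (adj.counit.app _) ≫ 𝟙 _
        rw [ind.mul_eq]
        simp)
  have hs : section_ (adj.counit.app Y) ≫ adj.counit.app Y = 𝟙 Y := IsSplitEpi.id _
  refine ⟨ρ.obj Y, ⟨{
    i := e.inv ≫ (comparison ind).map (section_ (adj.counit.app Y)) ≫ k.hom
    r := k.inv ≫ (comparison ind).map (adj.counit.app Y) ≫ e.hom
    retract := ?_ }⟩⟩
  simp only [Category.assoc, Iso.hom_inv_id_assoc]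
  rw [← (comparison ind).map_comp_assoc]
  erw [hs]
  simp

end Abelian

end HopfMonad

/-! ### Linearity of the adjoint and conclusion. -/

/-- The left adjoint of a linear functor is linear. -/
lemma linear_leftAdjoint {C : Type u₁} [Category.{v₁} C] [Preadditive C] [Linear ℂ C] {F : Type u₂}
    [Category.{v₂} F] [Preadditive F] [Linear ℂ F] {G : C ⥤ F} {ρ : F ⥤ C} (adj : G ⊣ ρ)
    [ρ.Linear ℂ] : G.Linear ℂ where
  map_smul {X Y} f c := (adj.homEquiv _ _).injective (by
    have h1 : f ≫ adj.unit.app Y = adj.unit.app X ≫ ρ.map (G.map f) := adj.unit.naturality f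
    have h2 : (c • f) ≫ adj.unit.app Y = adj.unit.app X ≫ ρ.map (G.map (c • f)) :=
      adj.unit.naturality (c • f)
    rw [adj.homEquiv_unit, adj.homEquiv_unit, ρ.map_smul, Linear.comp_smul, ← h1, ← h2]
    exact Linear.smul_comp _ _ _ _ _ _)

theorem proposition1 {C : Type u₁} [Category.{v₁} C] [Preadditive C] [Linear ℂ C]
    [MonoidalCategory C] [IsFusionCategory C] :
    (∀ (T : C ⥤ C) [T.Additive] [T.Linear ℂ] (h : HopfMonad T), h.IsSemisimple →
      IsCategorySymmetry C h.Mod h.forget) ∧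
    (∀ (F : Type u₂) [Category.{v₂} F] [Preadditive F] [Linear ℂ F] [MonoidalCategory F]
      (ρ : F ⥤ C) [ρ.Monoidal], IsCategorySymmetry C F ρ →
      ρ.IsRightAdjoint ∧
      ∀ (G : C ⥤ F) (adj : G ⊣ ρ),
        ∃ (_ : (G ⋙ ρ).Additive) (_ : (G ⋙ ρ).Linear ℂ) (h : HopfMonad (G ⋙ ρ)),
          h.IsSemisimple ∧ h.IsInducedBy adj ∧
          ∃ (K : F ⥤ h.Mod) (_ : K.Monoidal) (e : K ⋙ h.forget ≅ ρ),
            K.IsEquivalence ∧ K.Additive ∧ K.Linear ℂ ∧ NatTrans.IsMonoidal e.hom ∧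
            ∀ Y : F, (K.obj Y).a ≫ e.hom.app Y =
              ρ.map (G.map (e.hom.app Y)) ≫ ρ.map (adj.counit.app Y)) := by
  -- Substituting makes the given preadditive structure definitionally that of the abelian category.
  obtain ⟨A, rfl⟩ := IsFusionCategory.abelian (C := C)
  refine ⟨fun T _ _ h hss => h.isCategorySymmetry_mod T hss, ?_⟩
  intro F _ _ _ _ ρ _ ⟨hF, hρ⟩
  obtain ⟨B, rfl⟩ := hF.abelian
  have := hρ.additive
  have := hρ.linear
  have := hρ.faithful
  have := hρ.preservesFiniteLimits
  have := hρ.preservesFiniteColimits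
  have hfinC : ∀ X Y : C, Module.Finite ℂ (X ⟶ Y) := IsFusionCategory.finite_hom
  have hfinF : ∀ X Y : F, Module.Finite ℂ (X ⟶ Y) := hF.finite_hom
  obtain ⟨_⟩ := hF.rigid
  refine ⟨isRightAdjoint_of_semisimple hF.semisimple hF.finite_simples ρ, fun G adj => ?_⟩
  have : G.Additive := adj.left_adjoint_additive
  have : G.Linear ℂ := linear_leftAdjoint adj
  obtain ⟨h, ind⟩ := exists_hopfMonad_isInducedBy adj
  refine ⟨inferInstance, inferInstance, h,
    ind.isSemisimple fun f _ => hF.isSplitEpi f, ind,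
    HopfMonad.comparison ind, (HopfMonad.comparisonCoreMonoidal ind).toMonoidal,
    HopfMonad.comparisonForget ind, HopfMonad.comparison_isEquivalence ind,
    ⟨Monad.Algebra.Hom.ext ρ.map_add⟩, ⟨fun f c => Monad.Algebra.Hom.ext (ρ.map_smul c f)⟩,
    HopfMonad.comparisonForget_isMonoidal ind, fun Y => ?_⟩
  change ρ.map (adj.counit.app Y) ≫ 𝟙 (ρ.obj Y) =
    ρ.map (G.map (𝟙 (ρ.obj Y))) ≫ ρ.map (adj.counit.app Y)
  simp
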